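/- Let $d\ge 0$. For $z=(x,\omega)\in\mathbb R^{2d}$ let $\pi(z)f(t)=e^{2\pi i\omega\cdot t}f(t-x)$, let $Pf(t)=f(-t)$, let $\alpha_z(S)=\pi(z)S\pi(z)^*$ for bounded operators $S$ on $L^2(\mathbb R^d)$, and let $\Omega(z,z')=x'\cdot\omega-x\cdot\omega'$. Let $M^1(\mathbb R^n)$ be Feichtinger's algebra, i.e. the space of $f\in L^2(\mathbb R^n)$ with $\|f\|_{M^1}=\|V_{\varphi_0}f\|_{L^1}<\infty$, where $V_gf(z)=\langle f,\pi(z)g\rangle$ and $\varphi_0$ is the normalised Gaussian, and let $M^\infty(\mathbb R^n)$ be its dual, the space of continuous antilinear functionals on $M^1(\mathbb R^n)$, with bracket $\langle\sigma,F\rangle$. Let $\mathcal M^\infty$ be the space of bounded operators $M^1(\mathbb R^d)\to M^\infty(\mathbb R^d)$. Let $A(f,g)(x,\omega)=e^{i\pi x\cdot\omega}V_gf(x,\omega)$, $W(f,g)(x,\omega)=\int_{\mathbb R^d}f(x+\tfrac t2)\overline{g(x-\tfrac t2)}e^{-2\pi i\omega\cdot t}\,dt$, and let $\mathcal F_\Omega$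 be the extension to $L^2(\mathbb R^{2d})$ of $\mathcal F_\Omega a(z)=\int a(z')e^{-2\pi i\Omega(z,z')}\,dz'$. For $\sigma\in M^\infty(\mathbb R^{2d})$ and a family $B(z)$ of bounded operators on $L^2(\mathbb R^d)$, the identity $S=\int\sigma(z)B(z)\,dz$ with $S\in\mathcal M^\infty$ means that for all $f,g\in M^1(\mathbb R^d)$ the function $F(z)=\overline{\langle B(z)f,g\rangle}$ belongs to $M^1(\mathbb R^{2d})$ and $\langle Sf,g\rangle=\langle\sigma,F\rangle$. (1) For each $z\in\mathbb R^{2d}$ there is exactly one bounded operator $T$ on $L^2(\mathbb R^d)$ such that for all $f,g\in M^1(\mathbb R^d)$ the function $z'=(x',\omega')\mapsto e^{2\pi i\Omega(z,z')-i\pi x'\cdot\omega'}\langle\pi(z')f,g\rangle$ is integrable with integral $\langle Tf,g\rangle$, namely $T=2^d\alpha_z(P)$; that is, $$\int_{\mathbb R^{2d}}e^{2\pi i\Omega(z,z')-i\pi x'\cdot\omega'}\pi(z')\,dz'=2^d\alpha_z(P).$$ This operator defines an element of $\mathcal M^\infty$. Moreover, for all $f,g\in L^2(\mathbb R^d)$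 one has $A(f,g)\in L^2(\mathbb R^{2d})$ and $\mathcal F_\Omega(A(f,g))(z)=\langle f,2^d\alpha_z(P)g\rangle$ for almost every $z$. (2) For each $\sigma\in M^\infty(\mathbb R^{2d})$ there is exactly one $L_\sigma\in\mathcal M^\infty$, the Weyl quantisation of $\sigma$, such that for all $f,g\in M^1(\mathbb R^d)$ one has $W(g,f)\in M^1(\mathbb R^{2d})$ and $\langle L_\sigma f,g\rangle=\langle\sigma,W(g,f)\rangle$. It satisfies $$L_\sigma=2^d\int_{\mathbb R^{2d}}\sigma(z)\,\alpha_z(P)\,dz$$ and equivalently $$L_\sigma=2^{-d}\int_{\mathbb R^{2d}}\sigma(\tfrac z2)\,e^{-\pi i x\cdot\omega}\,\pi(z)P\,dz,$$ where $\sigma(\tfrac{\cdot}{2})\in M^\infty(\mathbb R^{2d})$ is the dilated distribution, $\langle\sigma(\tfrac\cdot2),F\rangle=\langle\sigma,2^{2d}F(2\,\cdot)\rangle$ for all $F\in M^1(\mathbb R^{2d})$ (and $2^{2d}F(2\,\cdot)\in M^1(\mathbb R^{2d})$ for such $F$). -/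

import Mathlib

open MeasureTheory Filter
open scoped FourierTransform

noncomputable section

namespace TimeFreq

/-- `ℝⁿ` (with `n` the number of elements of `ι`) with its Euclidean structure. -/
abbrev E (ι : Type) [Fintype ι] : Type := EuclideanSpace ℝ ι

/-- The space `L²(ℝⁿ)`. -/
abbrev L2 (ι : Type) [Fintype ι] : Type := Lp (α := E ι) ℂ 2 volume

/-- Bounded operators on `L²(ℝⁿ)`. -/
abbrev BoundedOp (ι : Type) [Fintype ι] : Type := L2 ι →L[ℂ] L2 ι

variable {ι : Type} [Fintype ι]

/-- The position part `x` of a point `z = (x, ω)` of phase space `ℝⁿ × ℝⁿ = ℝ²ⁿ`. -/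
def pos (z : E (ι ⊕ ι)) : E ι := WithLp.toLp 2 fun i => z (Sum.inl i)

/-- The frequency part `ω` of a point `z = (x, ω)` of phase space. -/
def freq (z : E (ι ⊕ ι)) : E ι := WithLp.toLp 2 fun i => z (Sum.inr i)

/-- The point `(x, ω)` of phase space. -/
def point (x ω : E ι) : E (ι ⊕ ι) := WithLp.toLp 2 (Sum.elim (fun i => x i) (fun i => ω i))

/-- The symplectic form `Ω(z, z') = x' · ω - x · ω'`. -/
def sympl (z z' : E (ι ⊕ ι)) : ℝ :=
  inner ℝ (pos z') (freq z) - inner ℝ (pos z) (freq z')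

/-- The `L²` inner product `⟨f, g⟩ = ∫ f(t) conj(g(t)) dt`, linear in the first slot. -/
def ip (f g : L2 ι) : ℂ := inner ℂ g f

/-! ### Translation, modulation, time-frequency shifts, parity -/

theorem measurePreserving_sub (x : E ι) :
    MeasurePreserving (fun t : E ι => t - x) volume volume :=
  measurePreserving_sub_right volume x

theorem measurePreserving_neg : MeasurePreserving (fun t : E ι => -t) volume volume :=
  Measure.measurePreserving_neg volume

/-- The translation `T_x f(t) = f(t - x)`. -/
def translation (x : E ι) : BoundedOp ι :=
  (Lp.compMeasurePreservingₗᵢ ℂ (fun t : E ι => t - x)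
    (measurePreserving_sub x)).toContinuousLinearMap

/-- The parity operator `P f(t) = f(-t)`. -/
def parity : BoundedOp ι :=
  (Lp.compMeasurePreservingₗᵢ ℂ (fun t : E ι => -t)
    measurePreserving_neg).toContinuousLinearMap

/-- The character `t ↦ exp(2πi ω · t)`. -/
def character (ω t : E ι) : ℂ :=
  Complex.exp (2 * Real.pi * Complex.I * ((inner ℝ ω t : ℝ) : ℂ))

theorem norm_character (ω t : E ι) : ‖character ω t‖ = 1 := by
  have h : (2 * Real.pi * Complex.I * ((inner ℝ ω t : ℝ) : ℂ))
      = ((2 * Real.pi * (inner ℝ ω t : ℝ) : ℝ) : ℂ) * Complex.I := by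
    push_cast; ring
  rw [character, h, Complex.norm_exp_ofReal_mul_I]

theorem continuous_character (ω : E ι) : Continuous (character ω) := by
  unfold character
  fun_prop

theorem memLp_character_mul (ω : E ι) (f : L2 ι) :
    MemLp (fun t => character ω t * f t) 2 volume :=
  (Lp.memLp f).of_le ((continuous_character ω).aestronglyMeasurable.mul
    (Lp.memLp f).aestronglyMeasurable)
    (Eventually.of_forall fun t => by simp [norm_character])

/-- The modulation `M_ω f(t) = exp(2πi ω · t) f(t)`. -/
def modulation (ω : E ι) : BoundedOp ι :=
  LinearIsometry.toContinuousLinearMap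
    { toFun := fun f => (memLp_character_mul ω f).toLp _
      map_add' := fun f g => by
        apply Lp.ext
        filter_upwards [(memLp_character_mul ω (f + g)).coeFn_toLp,
          (memLp_character_mul ω f).coeFn_toLp, (memLp_character_mul ω g).coeFn_toLp,
          Lp.coeFn_add f g,
          Lp.coeFn_add ((memLp_character_mul ω f).toLp _)
            ((memLp_character_mul ω g).toLp _)] with t h1 h2 h3 h4 h5
        rw [h1, h5, Pi.add_apply, h2, h3, h4, Pi.add_apply, mul_add]
      map_smul' := fun c f => by
        apply Lp.ext
        filter_upwards [(memLp_character_mul ω (c • f)).coeFn_toLp,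
          (memLp_character_mul ω f).coeFn_toLp, Lp.coeFn_smul c f,
          Lp.coeFn_smul c ((memLp_character_mul ω f).toLp _)] with t h1 h2 h3 h4
        simp only [RingHom.id_apply]
        rw [h1, h4, Pi.smul_apply, h2, h3, Pi.smul_apply, smul_eq_mul, smul_eq_mul]
        ring
      norm_map' := fun f => by
        simp only [LinearMap.coe_mk, AddHom.coe_mk]
        rw [Lp.norm_toLp, Lp.norm_def]
        congr 1
        exact eLpNorm_congr_norm_ae
          (Eventually.of_forall fun t => by simp [norm_character]) }

/-- The time-frequency shift `π(z) = M_ω T_x`, `z = (x, ω)`. -/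
def tfShift (z : E (ι ⊕ ι)) : BoundedOp ι := modulation (freq z) ∘L translation (pos z)

/-- The operator translation `α_z(S) = π(z) S π(z)^*`. -/
def opTranslate (z : E (ι ⊕ ι)) (S : BoundedOp ι) : BoundedOp ι :=
  tfShift z ∘L S ∘L ContinuousLinearMap.adjoint (tfShift z)

/-! ### Short-time Fourier transform, ambiguity function, Wigner distribution -/

/-- The short-time Fourier transform `V_g f(z) = ⟨f, π(z) g⟩`. -/
def stft (g f : L2 ι) (z : E (ι ⊕ ι)) : ℂ := ip f (tfShift z g)

/-- The ambiguity function `A(f, g)(x, ω) = exp(iπ x · ω) V_g f(x, ω)`. -/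
def ambiguity (f g : L2 ι) (z : E (ι ⊕ ι)) : ℂ :=
  Complex.exp (Complex.I * Real.pi * ((inner ℝ (pos z) (freq z) : ℝ) : ℂ)) * stft g f z

/-- The cross-Wigner distribution
`W(f, g)(x, ω) = ∫ f(x + t/2) conj(g(x - t/2)) exp(-2πi ω · t) dt`. -/
def wigner (f g : L2 ι) (z : E (ι ⊕ ι)) : ℂ :=
  ∫ t : E ι, f (pos z + (1 / 2 : ℝ) • t) * starRingEnd ℂ (g (pos z - (1 / 2 : ℝ) • t)) *
    Complex.exp (-2 * Real.pi * Complex.I * ((inner ℝ (freq z) t : ℝ) : ℂ))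

/-- The symplectic Fourier transform on `L²(ℝ²ⁿ)`, i.e. the extension by continuity of
`F_Ω f(z) = ∫ f(z') exp(-2πi Ω(z, z')) dz'`. As `Ω(z, z') = z' · (ω, -x)` for `z = (x, ω)`, it is
the Fourier-Plancherel transform evaluated at `(ω, -x)`; it is determined almost everywhere. -/
def symplFourier (a : L2 (ι ⊕ ι)) (z : E (ι ⊕ ι)) : ℂ :=
  (𝓕 a : L2 (ι ⊕ ι)) (point (freq z) (-pos z))

/-! ### Feichtinger's algebra `M¹`, its dual `M^∞`, and the operators `M¹ → M^∞` -/

/-- The `L²`-normalised Gaussian `2^{n/4} exp(-π |t|²)` on `ℝⁿ`. -/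
def gaussianFun (t : E ι) : ℂ :=
  (((2 : ℝ) ^ ((Fintype.card ι : ℝ) / 4) * Real.exp (-Real.pi * ‖t‖ ^ 2) : ℝ) : ℂ)

theorem memLp_gaussianFun : MemLp (gaussianFun (ι := ι)) 2 volume := by
  have hc : Continuous (gaussianFun (ι := ι)) := by
    unfold gaussianFun
    fun_prop
  rw [memLp_two_iff_integrable_sq_norm hc.aestronglyMeasurable]
  have h := (GaussianFourier.integrable_cexp_neg_mul_sq_norm_add (V := E ι)
    (b := ((2 * Real.pi : ℝ) : ℂ)) (by simpa using Real.pi_pos) 0 0).norm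
  refine (h.const_mul (((2 : ℝ) ^ ((Fintype.card ι : ℝ) / 4)) ^ 2)).congr
    (Eventually.of_forall fun t => ?_)
  have h2 : (0 : ℝ) < (2 : ℝ) ^ ((Fintype.card ι : ℝ) / 4) := by positivity
  have h3 : (-((2 * Real.pi : ℝ) : ℂ) * (‖t‖ : ℂ) ^ 2 + 0 * ((inner ℝ (0 : E ι) t : ℝ) : ℂ))
      = ((-(2 * Real.pi) * ‖t‖ ^ 2 : ℝ) : ℂ) := by
    push_cast; ring
  simp only [gaussianFun]
  rw [h3, Complex.norm_exp_ofReal, Complex.norm_real, Real.norm_eq_abs,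
    abs_of_pos (mul_pos h2 (Real.exp_pos _)), mul_pow, ← Real.exp_nat_mul]
  congr 2
  push_cast
  ring

/-- The normalised Gaussian window as an element of `L²`. -/
def gaussian : L2 ι := memLp_gaussianFun.toLp _

theorem stft_add (g f₁ f₂ : L2 ι) : stft g (f₁ + f₂) = stft g f₁ + stft g f₂ := by
  funext z; simp [stft, ip, inner_add_right]

theorem stft_smul (g : L2 ι) (c : ℂ) (f : L2 ι) : stft g (c • f) = c • stft g f := by
  funext z; simp [stft, ip, inner_smul_right]

/-- The elements of `L²(ℝⁿ)` whose short-time Fourier transform with Gaussian window is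
integrable. -/
def feichtinger (ι : Type) [Fintype ι] : Submodule ℂ (L2 ι) where
  carrier := {f | Integrable (stft gaussian f) volume}
  zero_mem' := by
    have h : stft gaussian (0 : L2 ι) = 0 := by funext z; simp [stft, ip]
    simp [h]
  add_mem' := fun {f g} hf hg => by
    simp only [Set.mem_ofPred_eq, stft_add] at *
    exact hf.add hg
  smul_mem' := fun c f hf => by
    simp only [Set.mem_ofPred_eq, stft_smul] at *
    exact hf.smul c

/-- Feichtinger's algebra `M¹(ℝⁿ)`; it is a type of its own since its norm is not the one of
`L²`. -/
def M1 (ι : Type) [Fintype ι] : Type := feichtinger ι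

instance : AddCommGroup (M1 ι) := inferInstanceAs (AddCommGroup (feichtinger ι))

instance : Module ℂ (M1 ι) := inferInstanceAs (Module ℂ (feichtinger ι))

/-- The inclusion of `M¹` in `L²`. -/
def M1.toL2 : M1 ι →ₗ[ℂ] L2 ι := (feichtinger ι).subtype

instance : CoeOut (M1 ι) (L2 ι) := ⟨fun f => M1.toL2 f⟩

theorem M1.integrable (f : M1 ι) : Integrable (stft gaussian (f : L2 ι)) volume := f.2

/-- The norm `‖f‖_{M¹} = ‖V_{φ₀} f‖_{L¹}`, `φ₀` the normalised Gaussian. -/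
instance : Norm (M1 ι) := ⟨fun f => ∫ z, ‖stft gaussian (f : L2 ι) z‖⟩

theorem M1.norm_def (f : M1 ι) : ‖f‖ = ∫ z, ‖stft gaussian (f : L2 ι) z‖ := rfl

theorem M1.core : SeminormedSpace.Core ℂ (M1 ι) where
  norm_nonneg f := integral_nonneg fun _ => norm_nonneg _
  norm_smul c f := by
    rw [M1.norm_def, M1.norm_def, map_smul, stft_smul, ← integral_const_mul]
    simp
  norm_triangle f g := by
    rw [M1.norm_def, M1.norm_def, M1.norm_def, map_add, stft_add,
      ← integral_add f.integrable.norm g.integrable.norm]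
    exact integral_mono (f.integrable.add g.integrable).norm
      (f.integrable.norm.add g.integrable.norm) fun z => norm_add_le _ _

instance : SeminormedAddCommGroup (M1 ι) := SeminormedAddCommGroup.ofCore M1.core

instance : NormedSpace ℂ (M1 ι) := { norm_smul_le := fun c f => (M1.core.norm_smul c f).le }

/-- `M^∞(ℝⁿ)`, the space of continuous antilinear functionals on `M¹(ℝⁿ)`; the duality bracket
`⟨σ, F⟩` is `σ F`. -/
abbrev MInf (ι : Type) [Fintype ι] : Type := M1 ι →L⋆[ℂ] ℂ

/-- The operators of class `𝓜^∞`: bounded operators from `M¹(ℝⁿ)` to `M^∞(ℝⁿ)`. The bracket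
`⟨S f, g⟩` is `S f g`. -/
abbrev MInfOp (ι : Type) [Fintype ι] : Type := M1 ι →L[ℂ] MInf ι

/-- `HasBracket σ F c`: the function `F` belongs to `M¹` and `⟨σ, F⟩ = c`. -/
def HasBracket (σ : MInf ι) (F : E ι → ℂ) (c : ℂ) : Prop :=
  ∃ m : M1 ι, ((m : L2 ι) : E ι → ℂ) =ᵐ[volume] F ∧ σ m = c

/-- The operator `S : M¹ → M^∞` is the one given by the bounded operator `T` on `L²`:
`⟨S f, g⟩ = ⟨T f, g⟩` for `f, g ∈ M¹`. -/
def IsInducedBy (S : MInfOp ι) (T : BoundedOp ι) : Prop :=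
  ∀ f g : M1 ι, S f g = ip (T f) g

/-- `T = ∫ A(z) dz` in the weak sense: for all `f, g` in the dense subspace `M¹` of `L²` the
function `z ↦ ⟨A(z) f, g⟩` is integrable with integral `⟨T f, g⟩`. -/
def HasWeakIntegral (A : E (ι ⊕ ι) → BoundedOp ι) (T : BoundedOp ι) : Prop :=
  ∀ f g : M1 ι, Integrable (fun z => ip (A z f) g) volume ∧
    ∫ z, ip (A z f) g = ip (T f) g

/-- `S = ∫ σ(z) A(z) dz` for a distribution `σ ∈ M^∞(ℝ²ⁿ)`, in the sense of duality:
`⟨S f, g⟩ = ∫ σ(z) ⟨A(z) f, g⟩ dz = ⟨σ, F⟩` with `F(z) = conj ⟨A(z) f, g⟩` in `M¹(ℝ²ⁿ)`, for all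
`f, g ∈ M¹(ℝⁿ)`. -/
def HasDualIntegral (σ : MInf (ι ⊕ ι)) (A : E (ι ⊕ ι) → BoundedOp ι) (S : MInfOp ι) : Prop :=
  ∀ f g : M1 ι, HasBracket σ (fun z => starRingEnd ℂ (ip (A z f) g)) (S f g)

/-- `L` is the Weyl quantisation `L_σ` of `σ`: `⟨L f, g⟩ = ⟨σ, W(g, f)⟩` for all `f, g ∈ M¹`. -/
def IsWeylQuantisation (σ : MInf (ι ⊕ ι)) (L : MInfOp ι) : Prop :=
  ∀ f g : M1 ι, HasBracket σ (wigner (g : L2 ι) (f : L2 ι)) (L f g)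

/-- `τ` is the dilated distribution `τ(z) = σ(z/2)` on `ℝᵐ`:
`⟨τ, F⟩ = ∫ σ(z/2) conj(F(z)) dz = ⟨σ, 2ᵐ F(2 ·)⟩` for all `F ∈ M¹(ℝᵐ)`. -/
def IsHalfDilation (σ τ : MInf ι) : Prop :=
  ∀ F : M1 ι, HasBracket σ
    (fun z => (2 : ℂ) ^ Fintype.card ι * (F : L2 ι) ((2 : ℝ) • z)) (τ F)

/-- The phase `exp(2πi Ω(z, z') - iπ x' · ω')`. -/
def phase (z z' : E (ι ⊕ ι)) : ℂ :=
  Complex.exp (2 * Real.pi * Complex.I * (sympl z z' : ℂ)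
    - Complex.I * Real.pi * ((inner ℝ (pos z') (freq z') : ℝ) : ℂ))

/-- The operator `exp(-πi x · ω) π(z) P`, `z = (x, ω)`. -/
def shiftedParity (z : E (ι ⊕ ι)) : BoundedOp ι :=
  Complex.exp (-(Real.pi * Complex.I * ((inner ℝ (pos z) (freq z) : ℝ) : ℂ))) •
    (tfShift z ∘L parity)

end TimeFreq

end

open TimeFreq

open MeasureTheory Filter
open scoped FourierTransform ENNReal Topology

noncomputable section

namespace TimeFreq

variable {ι κ : Type} [Fintype ι] [Fintype κ]

/-! ### Phase space -/

/-! Everything rests on the symmetric shifts `ρ(z) = exp(-iπ x·ω) π(z)`, called `symShift`. They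
satisfy `ρ(z)ρ(w) = exp(iπΩ(z,w)) ρ(z+w)`, `ρ(z)^* = ρ(-z)` and `Pρ(z) = ρ(-z)P`. Since `Ω(z,z) =
0`, it follows that `α_z(P) = ρ(z)Pρ(-z) = ρ(2z)P`. Moreover `A(f,g)(z) = ⟨f, ρ(z)g⟩`, so that `⟨f,
2ⁿ α_z(P) g⟩ = 2ⁿ A(f,Pg)(2z)`, and a change of variables identifies this with `W(f,g)(z)`.

Part (1) thus becomes `F_Ω A(f,g) = 2ⁿ A(f,Pg)(2·)`. Both sides are bounded sesquilinear maps `L² ×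
L² → L²`, so it suffices to compare them on the shifted Gaussians `ρ(u)φ₀`, whose span is dense by
Moyal's identity. There `A(ρ(u)φ₀, ρ(v)φ₀)` is a time-frequency shift of a Gaussian on `ℝ²ⁿ`, and
its Fourier transform is explicit (`symplFourier_ambiguity_gaussian`,
`symplFourierCLM_ambiguityL2`). For `f, g ∈ M¹` the ambiguity function is integrable, and continuity
turns the almost everywhere identity into one at every `z`.

Part (2) needs `W(g,f) ∈ M¹(ℝ²ⁿ)` with a norm bound. By Moyal's identity every `f` is a
superposition of the atoms `ρ(u)φ₀` with weight `A(f,φ₀)`, whose `L¹` norm is the `M¹` norm. A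
bounded map on `L²` whose values on the atoms are uniformly bounded in `M¹` therefore maps `M¹` to
`M¹` (`m1Norm_map_le`, `m1Norm_map_conjLinear_le`). Parity, dilation and the ambiguity map send
atoms to time-frequency shifts of a fixed Gaussian, so this applies to each of them. The two
integral formulas then only redistribute the powers of 2. -/

@[simp] theorem pos_point (x ω : E ι) : pos (point x ω) = x := rfl
@[simp] theorem freq_point (x ω : E ι) : freq (point x ω) = ω := rfl

theorem point_pos_freq (z : E (ι ⊕ ι)) : point (pos z) (freq z) = z := by
  ext i; cases i <;> rfl

@[simp] theorem pos_add (z w : E (ι ⊕ ι)) : pos (z + w) = pos z + pos w := rfl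
@[simp] theorem freq_add (z w : E (ι ⊕ ι)) : freq (z + w) = freq z + freq w := rfl
@[simp] theorem pos_sub (z w : E (ι ⊕ ι)) : pos (z - w) = pos z - pos w := rfl
@[simp] theorem freq_sub (z w : E (ι ⊕ ι)) : freq (z - w) = freq z - freq w := rfl
@[simp] theorem pos_neg (z : E (ι ⊕ ι)) : pos (-z) = -pos z := rfl
@[simp] theorem freq_neg (z : E (ι ⊕ ι)) : freq (-z) = -freq z := rfl
@[simp] theorem pos_smul (c : ℝ) (z : E (ι ⊕ ι)) : pos (c • z) = c • pos z := rfl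
@[simp] theorem freq_smul (c : ℝ) (z : E (ι ⊕ ι)) : freq (c • z) = c • freq z := rfl
@[simp] theorem pos_zero : pos (0 : E (ι ⊕ ι)) = 0 := rfl
@[simp] theorem freq_zero : freq (0 : E (ι ⊕ ι)) = 0 := rfl

theorem continuous_pos : Continuous (pos : E (ι ⊕ ι) → E ι) :=
  (PiLp.continuous_toLp 2 _).comp (by fun_prop)

theorem continuous_freq : Continuous (freq : E (ι ⊕ ι) → E ι) :=
  (PiLp.continuous_toLp 2 _).comp (by fun_prop)

theorem inner_eq_pos_add_freq (z w : E (ι ⊕ ι)) :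
    (inner ℝ z w : ℝ) = inner ℝ (pos z) (pos w) + inner ℝ (freq z) (freq w) := by
  simp [PiLp.inner_apply, Fintype.sum_sum_type, pos, freq]

theorem norm_sq_eq_pos_add_freq (z : E (ι ⊕ ι)) :
    ‖z‖ ^ 2 = ‖pos z‖ ^ 2 + ‖freq z‖ ^ 2 := by
  simp only [← real_inner_self_eq_norm_sq, inner_eq_pos_add_freq]

/-- The rotation `(x, ω) ↦ (ω, -x)`, for which `Ω(z, z') = z' · J z`. -/
def rotation : E (ι ⊕ ι) →ₗ[ℝ] E (ι ⊕ ι) where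
  toFun z := point (freq z) (-pos z)
  map_add' z w := by ext i; cases i <;> simp [point, add_comm]
  map_smul' c z := by ext i; cases i <;> simp [point]

@[simp] theorem pos_rotation (z : E (ι ⊕ ι)) : pos (rotation z) = freq z := rfl
@[simp] theorem freq_rotation (z : E (ι ⊕ ι)) : freq (rotation z) = -pos z := rfl

@[simp] theorem rotation_rotation (z : E (ι ⊕ ι)) : rotation (rotation z) = -z := by
  conv_rhs => rw [← point_pos_freq (-z)]
  rfl

theorem norm_rotation (z : E (ι ⊕ ι)) : ‖rotation z‖ = ‖z‖ := by
  rw [← sq_eq_sq₀ (norm_nonneg _) (norm_nonneg _)]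
  simp [norm_sq_eq_pos_add_freq, add_comm]

/-- The rotation `(x, ω) ↦ (ω, -x)` as an isometry. -/
def rotationₗᵢ : E (ι ⊕ ι) ≃ₗᵢ[ℝ] E (ι ⊕ ι) where
  toLinearEquiv := LinearEquiv.ofLinearMap rotation (-rotation)
    (by ext1 z; simp) (by ext1 z; simp)
  norm_map' := norm_rotation

theorem measurePreserving_rotation :
    MeasurePreserving (rotation : E (ι ⊕ ι) → E (ι ⊕ ι)) volume volume :=
  (rotationₗᵢ (ι := ι)).measurePreserving

theorem sympl_eq_inner_rotation (z w : E (ι ⊕ ι)) : sympl z w = inner ℝ w (rotation z) := by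
  rw [inner_eq_pos_add_freq, sympl, pos_rotation, freq_rotation, inner_neg_right,
    real_inner_comm (pos z) (freq w), sub_eq_add_neg]

/-! ### Time-frequency shifts -/

theorem coeFn_translation (x : E ι) (f : L2 ι) :
    (translation x f : E ι → ℂ) =ᵐ[volume] fun t => f (t - x) :=
  Lp.coeFn_compMeasurePreserving f (measurePreserving_sub x)

theorem coeFn_parity (f : L2 ι) : (parity f : E ι → ℂ) =ᵐ[volume] fun t => f (-t) :=
  Lp.coeFn_compMeasurePreserving f measurePreserving_neg

theorem coeFn_modulation (ω : E ι) (f : L2 ι) :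
    (modulation ω f : E ι → ℂ) =ᵐ[volume] fun t => character ω t * f t :=
  (memLp_character_mul ω f).coeFn_toLp

theorem coeFn_tfShift (z : E (ι ⊕ ι)) (f : L2 ι) :
    (tfShift z f : E ι → ℂ) =ᵐ[volume] fun t => character (freq z) t * f (t - pos z) := by
  filter_upwards [coeFn_modulation (freq z) (translation (pos z) f),
    coeFn_translation (pos z) f] with t h1 h2
  rw [← h2, ← h1]; rfl

/-- The symmetric time-frequency shift `ρ(z) = exp(-iπ x · ω) π(z)`, `z = (x, ω)`. -/
def symShift (z : E (ι ⊕ ι)) : BoundedOp ι :=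
  Complex.exp (-(Real.pi * Complex.I * ((inner ℝ (pos z) (freq z) : ℝ) : ℂ))) • tfShift z

theorem coeFn_symShift (z : E (ι ⊕ ι)) (f : L2 ι) :
    (symShift z f : E ι → ℂ) =ᵐ[volume] fun t =>
      Complex.exp (Real.pi * Complex.I * ((inner ℝ (freq z) ((2 : ℝ) • t - pos z) : ℝ) : ℂ)) *
        f (t - pos z) := by
  filter_upwards [coeFn_tfShift z f,
    Lp.coeFn_smul (Complex.exp (-(Real.pi * Complex.I * ((inner ℝ (pos z) (freq z) : ℝ) : ℂ))))
      (tfShift z f)] with t h1 h2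
  change (Complex.exp (-(Real.pi * Complex.I * ((inner ℝ (pos z) (freq z) : ℝ) : ℂ))) •
    tfShift z f : L2 ι) t = _
  rw [h2, Pi.smul_apply, h1, smul_eq_mul, ← mul_assoc, character, ← Complex.exp_add,
    real_inner_comm]
  congr 2
  rw [inner_sub_right, inner_smul_right]
  push_cast; ring

theorem tfShift_eq_symShift (z : E (ι ⊕ ι)) :
    tfShift z =
      Complex.exp (Real.pi * Complex.I * ((inner ℝ (pos z) (freq z) : ℝ) : ℂ)) • symShift z := by
  rw [symShift, smul_smul, ← Complex.exp_add]
  simp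

theorem norm_exp_pi_I_mul (r : ℝ) : ‖Complex.exp (Real.pi * Complex.I * (r : ℂ))‖ = 1 := by
  have h : (Real.pi * Complex.I * (r : ℂ)) = ((Real.pi * r : ℝ) : ℂ) * Complex.I := by
    push_cast; ring
  rw [h, Complex.norm_exp_ofReal_mul_I]

theorem conj_exp_pi_I_mul (r : ℝ) :
    starRingEnd ℂ (Complex.exp (Real.pi * Complex.I * (r : ℂ))) =
      Complex.exp (-(Real.pi * Complex.I * (r : ℂ))) := by
  rw [← Complex.exp_conj]
  simp

theorem ip_smul_left (c : ℂ) (f g : L2 ι) : ip (c • f) g = c * ip f g := inner_smul_right _ _ _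

theorem ip_smul_right (c : ℂ) (f g : L2 ι) : ip f (c • g) = starRingEnd ℂ c * ip f g :=
  inner_smul_left _ _ _

theorem conj_ip (f g : L2 ι) : starRingEnd ℂ (ip f g) = ip g f := inner_conj_symm _ _

theorem norm_ip_le (f g : L2 ι) : ‖ip f g‖ ≤ ‖f‖ * ‖g‖ :=
  (norm_inner_le_norm g f).trans_eq (mul_comm _ _)

theorem ambiguity_eq (f g : L2 ι) (z : E (ι ⊕ ι)) : ambiguity f g z = ip f (symShift z g) := by
  have h : symShift z g = Complex.exp (-(Real.pi * Complex.I *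
      ((inner ℝ (pos z) (freq z) : ℝ) : ℂ))) • tfShift z g := rfl
  rw [ambiguity, stft, h, ip_smul_right, ← conj_exp_pi_I_mul, Complex.conj_conj,
    mul_comm Complex.I]

theorem norm_ambiguity (f g : L2 ι) (z : E (ι ⊕ ι)) : ‖ambiguity f g z‖ = ‖stft g f z‖ := by
  rw [ambiguity, norm_mul, mul_comm Complex.I, norm_exp_pi_I_mul, one_mul]

/-- The symmetric phase makes the cocycle antisymmetric, so inverses and squares carry no phase. -/
theorem symShift_symShift (z w : E (ι ⊕ ι)) (f : L2 ι) :
    symShift z (symShift w f) =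
      Complex.exp (Real.pi * Complex.I * (sympl z w : ℂ)) • symShift (z + w) f := by
  apply Lp.ext
  filter_upwards [coeFn_symShift z (symShift w f), coeFn_symShift (z + w) f,
    (measurePreserving_sub (pos z)).quasiMeasurePreserving.ae (coeFn_symShift w f),
    Lp.coeFn_smul (Complex.exp (Real.pi * Complex.I * (sympl z w : ℂ)))
      (symShift (z + w) f)] with t h1 h2 h3 h4
  rw [h1, h4, Pi.smul_apply, h2, h3, smul_eq_mul, ← mul_assoc, ← mul_assoc, ← Complex.exp_add,
    ← Complex.exp_add, pos_add, sub_sub]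
  congr 2
  rw [sympl]
  simp only [inner_sub_right, inner_smul_right, inner_add_left, inner_add_right, smul_sub,
    freq_add]
  rw [real_inner_comm (freq z) (pos w), real_inner_comm (freq w) (pos z)]
  push_cast; ring

theorem symShift_zero (f : L2 ι) : symShift 0 f = f := by
  apply Lp.ext
  filter_upwards [coeFn_symShift 0 f] with t h
  simp [h]

@[simp] theorem sympl_self (z : E (ι ⊕ ι)) : sympl z z = 0 := by
  rw [sympl, sub_self]

theorem symShift_neg_symShift (z : E (ι ⊕ ι)) (f : L2 ι) : symShift (-z) (symShift z f) = f := by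
  rw [symShift_symShift, neg_add_cancel, symShift_zero, sympl]
  simp

theorem symShift_symShift_neg (z : E (ι ⊕ ι)) (f : L2 ι) : symShift z (symShift (-z) f) = f := by
  simpa using symShift_neg_symShift (-z) f

theorem norm_tfShift (z : E (ι ⊕ ι)) (f : L2 ι) : ‖tfShift z f‖ = ‖f‖ := by
  rw [tfShift, ContinuousLinearMap.comp_apply, modulation, translation]
  simp only [LinearIsometry.coe_toContinuousLinearMap, LinearIsometry.norm_map]

theorem norm_symShift (z : E (ι ⊕ ι)) (f : L2 ι) : ‖symShift z f‖ = ‖f‖ := by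
  rw [symShift, smul_apply, norm_smul, ← conj_exp_pi_I_mul, RCLike.norm_conj,
    norm_exp_pi_I_mul, one_mul, norm_tfShift]

theorem norm_parity (f : L2 ι) : ‖parity f‖ = ‖f‖ := LinearIsometry.norm_map _ f

theorem ip_symShift_symShift (z : E (ι ⊕ ι)) (f g : L2 ι) :
    ip (symShift z f) (symShift z g) = ip f g :=
  LinearIsometry.inner_map_map
    (⟨(symShift z).toLinearMap, norm_symShift z⟩ : L2 ι →ₗᵢ[ℂ] L2 ι) g f

theorem ip_symShift_right (z : E (ι ⊕ ι)) (f g : L2 ι) :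
    ip f (symShift z g) = ip (symShift (-z) f) g := by
  rw [← ip_symShift_symShift z (symShift (-z) f), symShift_symShift_neg]

theorem adjoint_symShift (z : E (ι ⊕ ι)) :
    ContinuousLinearMap.adjoint (symShift z) = symShift (-z) := by
  rw [eq_comm, ContinuousLinearMap.eq_adjoint_iff]
  intro f g
  exact (ip_symShift_right (-z) g f).trans (by rw [neg_neg]; rfl)

/-- The scalar relating `π(z)` to `ρ(z)` is unimodular and cancels under conjugation. -/
theorem opTranslate_apply (z : E (ι ⊕ ι)) (S : BoundedOp ι) (f : L2 ι) :
    opTranslate z S f = symShift z (S (symShift (-z) f)) := by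
  rw [opTranslate, tfShift_eq_symShift, map_smulₛₗ, adjoint_symShift]
  simp only [ContinuousLinearMap.comp_apply, smul_apply, map_smul, smul_smul]
  rw [conj_exp_pi_I_mul, ← Complex.exp_add]
  simp

theorem parity_symShift (z : E (ι ⊕ ι)) (f : L2 ι) :
    parity (symShift z f) = symShift (-z) (parity f) := by
  apply Lp.ext
  filter_upwards [coeFn_parity (symShift z f), coeFn_symShift (-z) (parity f),
    measurePreserving_neg.quasiMeasurePreserving.ae (coeFn_symShift z f),
    (measurePreserving_sub (pos (-z))).quasiMeasurePreserving.ae (coeFn_parity f)]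
    with t h1 h2 h3 h4
  rw [h1, h2, h3, h4]
  simp only [pos_neg, freq_neg]
  congr 1
  · simp only [inner_sub_right, inner_smul_right, inner_neg_left, inner_neg_right]
    congr 3; ring
  · congr 1; abel

/-- Moving `P` to the right past `ρ(-z)` gives `ρ(z)ρ(z)P`, and `Ω(z,z) = 0`. This doubling of the
argument is the source of every dilation by 2 below. -/
theorem opTranslate_parity_apply (z : E (ι ⊕ ι)) (f : L2 ι) :
    opTranslate z parity f = symShift ((2 : ℝ) • z) (parity f) := by
  rw [opTranslate_apply, parity_symShift, neg_neg, symShift_symShift, two_smul]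
  simp

theorem shiftedParity_apply (z : E (ι ⊕ ι)) (f : L2 ι) :
    shiftedParity z f = symShift z (parity f) := rfl

/-- The chirp in the phase is exactly what symmetrises the shift; what remains is a symplectic
Fourier kernel. -/
theorem phase_smul_tfShift (z w : E (ι ⊕ ι)) :
    phase z w • tfShift w = Complex.exp (2 * Real.pi * Complex.I * (sympl z w : ℂ)) •
      symShift w := by
  rw [symShift, smul_smul, ← Complex.exp_add, phase]
  congr 2; ring

theorem ambiguity_conj_symm (f g : L2 ι) (z : E (ι ⊕ ι)) :
    starRingEnd ℂ (ambiguity f g z) = ambiguity g f (-z) := by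
  rw [ambiguity_eq, ambiguity_eq, ip_symShift_right, conj_ip]

/-! ### Continuity of time-frequency shifts -/

theorem ip_eq_integral (f g : L2 ι) : ip f g = ∫ t, f t * starRingEnd ℂ (g t) := by
  rw [ip, L2.inner_def]
  rfl

theorem continuous_translation_apply (f : L2 ι) : Continuous fun x : E ι => translation x f := by
  have h : Continuous fun x : E ι => (⟨fun t => t - x, by fun_prop⟩ : C(E ι, E ι)) := by
    refine ContinuousMap.continuous_of_continuous_uncurry _ ?_
    simp only [Function.uncurry_def, ContinuousMap.coe_mk]
    fun_prop
  exact Continuous.compMeasurePreservingLp (continuous_const (y := f)) h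
    (fun x => measurePreserving_sub x) (by norm_num)

theorem continuous_ip_modulation (f g : L2 ι) :
    Continuous fun ω : E ι => ip (modulation ω f) g := by
  have h : ∀ ω : E ι, ip (modulation ω f) g =
      ∫ t, character ω t * (f t * starRingEnd ℂ (g t)) := by
    intro ω
    rw [ip_eq_integral]
    refine integral_congr_ae ?_
    filter_upwards [coeFn_modulation ω f] with t ht
    rw [ht, mul_assoc]
  simp_rw [h]
  have hi : Integrable (fun t => f t * starRingEnd ℂ (g t)) volume := by
    simpa [mul_comm] using L2.integrable_inner (𝕜 := ℂ) g f
  refine continuous_of_dominated (bound := fun t => ‖f t * starRingEnd ℂ (g t)‖) ?_ ?_ hi.norm ?_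
  · exact fun ω => (continuous_character ω).aestronglyMeasurable.mul hi.aestronglyMeasurable
  · exact fun ω => Eventually.of_forall fun t => by rw [norm_mul, norm_character, one_mul]
  · refine Eventually.of_forall fun t => ?_
    unfold character
    fun_prop

theorem norm_modulation (ω : E ι) (f : L2 ι) : ‖modulation ω f‖ = ‖f‖ := by
  rw [modulation, LinearIsometry.coe_toContinuousLinearMap, LinearIsometry.norm_map]

/-- Translations are strongly continuous, modulations are isometric and weakly continuous; the two
are combined by varying the translation inside the modulation. -/
theorem continuous_ip_tfShift (f g : L2 ι) :
    Continuous fun z : E (ι ⊕ ι) => ip (tfShift z f) g := by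
  rw [continuous_iff_continuousAt]
  intro z₀
  have h1 : Tendsto (fun z : E (ι ⊕ ι) => ip (modulation (freq z) (translation (pos z₀) f)) g)
      (𝓝 z₀) (𝓝 (ip (tfShift z₀ f) g)) :=
    ((continuous_ip_modulation (translation (pos z₀) f) g).comp continuous_freq).tendsto z₀
  have h2 : Tendsto (fun z : E (ι ⊕ ι) =>
      ip (modulation (freq z) (translation (pos z) f - translation (pos z₀) f)) g)
      (𝓝 z₀) (𝓝 0) := by
    have h3 : Tendsto (fun z : E (ι ⊕ ι) => ‖translation (pos z) f - translation (pos z₀) f‖ * ‖g‖)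
        (𝓝 z₀) (𝓝 0) := by
      have h4 : Continuous fun z : E (ι ⊕ ι) =>
          ‖translation (pos z) f - translation (pos z₀) f‖ * ‖g‖ :=
        ((((continuous_translation_apply f).comp continuous_pos).sub
          continuous_const).norm).mul continuous_const
      simpa using h4.tendsto z₀
    exact squeeze_zero_norm (fun z => (norm_ip_le _ _).trans_eq (by rw [norm_modulation])) h3
  have h5 := h1.add h2
  rw [add_zero] at h5
  refine h5.congr fun z => ?_
  rw [tfShift, ContinuousLinearMap.comp_apply, map_sub]
  simp only [ip, ← inner_add_right, add_sub_cancel]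

theorem continuous_ip_symShift (f g : L2 ι) :
    Continuous fun z : E (ι ⊕ ι) => ip (symShift z f) g := by
  have h := continuous_pos (ι := ι)
  have h' := continuous_freq (ι := ι)
  simp only [symShift, smul_apply, ip_smul_left]
  exact Continuous.mul (by fun_prop) (continuous_ip_tfShift f g)

theorem continuous_ambiguity (f g : L2 ι) : Continuous (ambiguity f g) := by
  refine (Complex.continuous_conj.comp (continuous_ip_symShift g f)).congr fun z => ?_
  rw [Function.comp_apply, conj_ip, ambiguity_eq]

/-- Weak continuity of a family of isometries upgrades to strong continuity by expanding the squared
distance. -/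
theorem continuous_symShift_apply (f : L2 ι) : Continuous fun z : E (ι ⊕ ι) => symShift z f := by
  rw [continuous_iff_continuousAt]
  intro z₀
  rw [ContinuousAt, tendsto_iff_norm_sub_tendsto_zero]
  have h : ∀ z, ‖symShift z f - symShift z₀ f‖ =
      √(2 * ‖f‖ ^ 2 - 2 * (ip (symShift z f) (symShift z₀ f)).re) := by
    intro z
    rw [← Real.sqrt_sq (norm_nonneg (symShift z f - symShift z₀ f)), norm_sub_sq (𝕜 := ℂ),
      norm_symShift, norm_symShift, inner_re_symm]
    congr 1
    simp only [ip, RCLike.re_to_complex]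
    ring
  simp_rw [h]
  have hc : Continuous fun z =>
      √(2 * ‖f‖ ^ 2 - 2 * (ip (symShift z f) (symShift z₀ f)).re) := by
    have := continuous_ip_symShift f (symShift z₀ f)
    fun_prop
  convert hc.tendsto z₀ using 2
  have h0 := h z₀
  rwa [sub_self, norm_zero] at h0

/-! ### The Fourier transform on `L¹ ∩ L²` -/

theorem continuous_fourier {f : E ι → ℂ} (hf : Integrable f volume) : Continuous (𝓕 f) :=
  VectorFourier.fourierIntegral_continuous Real.continuous_fourierChar
    (by simpa using continuous_inner) hf

/-- Both transforms are tested against smooth compactly supported functions: the `L²` one agrees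
with the distributional transform, and the integral one can be moved to the test function by Fubini.
-/
theorem fourier_L2_ae_eq (f : L2 ι) (hf : Integrable f volume) :
    ((𝓕 f : L2 ι) : E ι → ℂ) =ᵐ[volume] 𝓕 (f : E ι → ℂ) := by
  refine ae_eq_of_integral_contDiff_smul_eq ((Lp.memLp (𝓕 f : L2 ι)).locallyIntegrable (by norm_num))
    (continuous_fourier hf).locallyIntegrable fun g hg hgc => ?_
  have hg₁ : HasCompactSupport (Complex.ofRealCLM ∘ g) := hgc.comp_left rfl
  have hg₂ : ContDiff ℝ ((⊤ : ℕ∞) : WithTop ℕ∞) (Complex.ofRealCLM ∘ g) := by fun_prop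
  set G : SchwartzMap (E ι) ℂ := hg₁.toSchwartzMap hg₂ with hG
  have hGg : ∀ t, G t = (g t : ℂ) := fun t => rfl
  have h1 := congrArg (fun T => T G) (Lp.fourier_toTemperedDistribution_eq f)
  simp only [TemperedDistribution.fourier_apply, Lp.toTemperedDistribution_apply] at h1
  have h2 := VectorFourier.integral_fourierIntegral_smul_eq_flip (𝕜 := ℝ) (L := innerₗ (E ι))
    (μ := volume) (ν := volume) (f := G) (g := f) Real.continuous_fourierChar
    (by simpa using continuous_inner) G.integrable hf
  rw [flip_innerₗ] at h2
  have h3 : ∫ t, G t • ((𝓕 f : L2 ι) t) = ∫ t, G t • 𝓕 (f : E ι → ℂ) t := by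
    rw [← h1]
    exact h2
  simpa [hGg] using h3

theorem lintegral_enorm_sq_coeFn (f : L2 ι) : ∫⁻ t, ‖f t‖ₑ ^ 2 = ‖f‖ₑ ^ 2 := by
  rw [Lp.enorm_def, eLpNorm_eq_lintegral_rpow_enorm_toReal two_ne_zero ENNReal.ofNat_ne_top,
    ← ENNReal.rpow_two, ← ENNReal.rpow_mul]
  simp

theorem lintegral_enorm_sq_fourier {f : E ι → ℂ} (h1 : Integrable f volume)
    (h2 : MemLp f 2 volume) : ∫⁻ ω, ‖𝓕 f ω‖ₑ ^ 2 = ∫⁻ t, ‖f t‖ₑ ^ 2 := by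
  have hf := h2.coeFn_toLp
  have h3 : ∀ ω, 𝓕 f ω = 𝓕 (h2.toLp f : E ι → ℂ) ω := fun ω =>
    Real.fourier_congr_ae hf.symm ω
  have h4 : ∫⁻ ω, ‖𝓕 f ω‖ₑ ^ 2 = ∫⁻ ω, ‖(𝓕 (h2.toLp f) : L2 ι) ω‖ₑ ^ 2 := by
    refine lintegral_congr_ae ?_
    filter_upwards [fourier_L2_ae_eq (h2.toLp f) (h1.congr hf.symm)] with ω hω
    rw [hω, h3]
  have h5 : ‖(𝓕 (h2.toLp f) : L2 ι)‖ₑ = ‖h2.toLp f‖ₑ := by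
    rw [← ofReal_norm, ← ofReal_norm, Lp.norm_fourier_eq]
  rw [h4, lintegral_enorm_sq_coeFn, h5, ← lintegral_enorm_sq_coeFn]
  refine lintegral_congr_ae ?_
  filter_upwards [hf] with t ht
  rw [ht]

/-! ### Moyal's identity -/

theorem measurePreserving_pos_freq :
    MeasurePreserving (fun z : E (ι ⊕ ι) => (pos z, freq z)) volume volume :=
  (WithLp.volume_preserving_ofLp (E ι) (E ι)).comp
    (PiLp.sumPiLpEquivProdLpPiLp (ι := ι) (κ := ι) 2 (fun _ => ℝ)
      : E (ι ⊕ ι) ≃ₗᵢ[ℝ] _).measurePreserving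

theorem continuous_stft (g f : L2 ι) : Continuous (stft g f) :=
  (Complex.continuous_conj.comp (continuous_ip_tfShift g f)).congr fun _ => conj_ip _ _

theorem stft_eq_fourier (g f : L2 ι) (z : E (ι ⊕ ι)) :
    stft g f z = 𝓕 (fun t => f t * starRingEnd ℂ (g (t - pos z))) (freq z) := by
  rw [stft, ip_eq_integral, Real.fourier_eq']
  refine integral_congr_ae ?_
  filter_upwards [coeFn_tfShift z g] with t ht
  have h : (2 * Real.pi * Complex.I * ((inner ℝ (freq z) t : ℝ) : ℂ)) =
      Real.pi * Complex.I * ((2 * inner ℝ (freq z) t : ℝ) : ℂ) := by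
    push_cast; ring
  rw [ht, map_mul, character, h, conj_exp_pi_I_mul, smul_eq_mul, real_inner_comm]
  have h' : -(Real.pi * Complex.I * ((2 * inner ℝ t (freq z) : ℝ) : ℂ)) =
      ((-2 * Real.pi * inner ℝ t (freq z) : ℝ) : ℂ) * Complex.I := by
    push_cast; ring
  rw [h']
  ring

/-- For fixed `x` the transform is a Fourier transform in `t`; Plancherel in `ω` followed by Tonelli
in `(x, t)` gives the product of norms. -/
theorem lintegral_enorm_sq_stft (g f : L2 ι) :
    ∫⁻ z, ‖stft g f z‖ₑ ^ 2 = ‖f‖ₑ ^ 2 * ‖g‖ₑ ^ 2 := by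
  have hfm : Measurable (f : E ι → ℂ) := (Lp.stronglyMeasurable f).measurable
  have hgm : Measurable (g : E ι → ℂ) := (Lp.stronglyMeasurable g).measurable
  set H : E ι → E ι → ℂ := fun x t => f t * starRingEnd ℂ (g (t - x)) with hH
  have hHm : Measurable (Function.uncurry H) := by
    refine (hfm.comp measurable_snd).mul ?_
    exact Complex.continuous_conj.measurable.comp
      (hgm.comp (measurable_snd.sub measurable_fst))
  have hH2 : ∫⁻ x, ∫⁻ t, ‖H x t‖ₑ ^ 2 = ‖f‖ₑ ^ 2 * ‖g‖ₑ ^ 2 := by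
    rw [lintegral_lintegral_swap (by exact (hHm.enorm.pow_const 2).aemeasurable)]
    have h : ∀ t, ∫⁻ x, ‖H x t‖ₑ ^ 2 = ‖f t‖ₑ ^ 2 * ‖g‖ₑ ^ 2 := by
      intro t
      simp only [hH, enorm_mul, mul_pow, RCLike.enorm_conj]
      rw [lintegral_const_mul _ (by fun_prop),
        lintegral_sub_left_eq_self (fun x => ‖g x‖ₑ ^ 2) t, lintegral_enorm_sq_coeFn]
    simp_rw [h]
    rw [lintegral_mul_const _ (by fun_prop), lintegral_enorm_sq_coeFn]
  have hK : Continuous fun p : E ι × E ι => stft g f (point p.1 p.2) := by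
    have h1 : Continuous fun p : E ι × E ι => (point p.1 p.2 : E (ι ⊕ ι)) := by
      refine (PiLp.continuous_toLp 2 _).comp (continuous_pi fun i => ?_)
      cases i <;> simp only [Sum.elim_inl, Sum.elim_inr] <;> fun_prop
    exact (continuous_stft g f).comp h1
  have h3 : ∫⁻ z, ‖stft g f z‖ₑ ^ 2 = ∫⁻ x, ∫⁻ ω, ‖𝓕 (H x) ω‖ₑ ^ 2 := by
    have h4 := (measurePreserving_pos_freq (ι := ι)).lintegral_comp
      (f := fun p => ‖stft g f (point p.1 p.2)‖ₑ ^ 2) (hK.measurable.enorm.pow_const 2)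
    simp only [point_pos_freq] at h4
    rw [h4, Measure.volume_eq_prod, lintegral_prod _ (hK.measurable.enorm.pow_const 2).aemeasurable]
    simp only [stft_eq_fourier, pos_point, freq_point, hH]
  rw [h3, ← hH2]
  refine lintegral_congr_ae ?_
  -- The slice `H x` is a product of two `L²` functions, hence always in `L¹`, but it lies in `L²`
  -- only for almost every `x`.
  have hfin : ∀ᵐ x, ∫⁻ t, ‖H x t‖ₑ ^ 2 < ∞ := by
    refine ae_lt_top (Measurable.lintegral_prod_right (hHm.enorm.pow_const 2)) ?_
    rw [hH2]
    exact ENNReal.mul_ne_top (by simp) (by simp)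
  filter_upwards [hfin] with x hx
  have hHx : AEStronglyMeasurable (H x) volume :=
    (hHm.comp measurable_prodMk_left).aestronglyMeasurable
  refine lintegral_enorm_sq_fourier ?_ ⟨hHx, ?_⟩
  · have hgx : MemLp (fun t => g (t - x)) 2 volume :=
      (Lp.memLp g).comp_measurePreserving (measurePreserving_sub x)
    exact (Lp.memLp f).integrable_mul (q := 2) hgx.star
  · rw [eLpNorm_lt_top_iff_lintegral_rpow_enorm_lt_top two_ne_zero ENNReal.ofNat_ne_top]
    simpa using hx

theorem lintegral_enorm_sq_ambiguity (f g : L2 ι) :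
    ∫⁻ z, ‖ambiguity f g z‖ₑ ^ 2 = ‖f‖ₑ ^ 2 * ‖g‖ₑ ^ 2 := by
  rw [← lintegral_enorm_sq_stft]
  refine lintegral_congr fun z => ?_
  rw [← ofReal_norm, ← ofReal_norm, norm_ambiguity]

theorem memLp_ambiguity (f g : L2 ι) : MemLp (ambiguity f g) 2 volume := by
  refine ⟨(continuous_ambiguity f g).aestronglyMeasurable, ?_⟩
  rw [eLpNorm_lt_top_iff_lintegral_rpow_enorm_lt_top two_ne_zero ENNReal.ofNat_ne_top]
  simp only [ENNReal.toReal_ofNat, ENNReal.rpow_ofNat]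
  rw [lintegral_enorm_sq_ambiguity]
  exact ENNReal.mul_lt_top (by simp) (by simp)

/-- The ambiguity function as an element of `L²`. -/
def ambiguityL2 (f g : L2 ι) : L2 (ι ⊕ ι) := (memLp_ambiguity f g).toLp _

theorem coeFn_ambiguityL2 (f g : L2 ι) :
    (ambiguityL2 f g : E (ι ⊕ ι) → ℂ) =ᵐ[volume] ambiguity f g :=
  (memLp_ambiguity f g).coeFn_toLp

theorem norm_ambiguityL2 (f g : L2 ι) : ‖ambiguityL2 f g‖ = ‖f‖ * ‖g‖ := by
  have h : ‖ambiguityL2 f g‖ₑ ^ 2 = (‖f‖ₑ * ‖g‖ₑ) ^ 2 := by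
    rw [← lintegral_enorm_sq_coeFn, mul_pow, ← lintegral_enorm_sq_ambiguity]
    refine lintegral_congr_ae ?_
    filter_upwards [coeFn_ambiguityL2 f g] with z hz
    rw [hz]
  have h' := ENNReal.pow_right_strictMono two_ne_zero |>.injective h
  simpa using congrArg ENNReal.toReal h'

theorem ip_add_left (f f' g : L2 ι) : ip (f + f') g = ip f g + ip f' g := inner_add_right _ _ _

theorem ip_add_right (f g g' : L2 ι) : ip f (g + g') = ip f g + ip f g' := inner_add_left _ _ _

theorem ambiguity_add_left (f f' g : L2 ι) :
    ambiguity (f + f') g = ambiguity f g + ambiguity f' g := by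
  funext z; simp only [Pi.add_apply, ambiguity_eq, ip_add_left]

theorem ambiguity_smul_left (c : ℂ) (f g : L2 ι) :
    ambiguity (c • f) g = c • ambiguity f g := by
  funext z; simp only [Pi.smul_apply, ambiguity_eq, ip_smul_left, smul_eq_mul]

theorem ambiguity_add_right (f g g' : L2 ι) :
    ambiguity f (g + g') = ambiguity f g + ambiguity f g' := by
  funext z; simp only [Pi.add_apply, ambiguity_eq, map_add, ip_add_right]

theorem ambiguity_smul_right (c : ℂ) (f g : L2 ι) :
    ambiguity f (c • g) = starRingEnd ℂ c • ambiguity f g := by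
  funext z; simp only [Pi.smul_apply, ambiguity_eq, map_smul, ip_smul_right, smul_eq_mul]

/-- The ambiguity function as a bounded sesquilinear map `L² × L² → L²`. -/
def ambiguityCLM : L2 ι →L[ℂ] L2 ι →L⋆[ℂ] L2 (ι ⊕ ι) :=
  LinearMap.mkContinuous₂
    (LinearMap.mk₂'ₛₗ (RingHom.id ℂ) (starRingEnd ℂ) ambiguityL2
      (fun f f' g => by
        simp only [ambiguityL2, ambiguity_add_left, ← MemLp.toLp_add])
      (fun c f g => by
        simp only [ambiguityL2, ambiguity_smul_left, ← MemLp.toLp_const_smul, RingHom.id_apply])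
      (fun f g g' => by
        simp only [ambiguityL2, ambiguity_add_right, ← MemLp.toLp_add])
      (fun c f g => by
        simp only [ambiguityL2, ambiguity_smul_right, ← MemLp.toLp_const_smul]))
    1 (fun f g => by
      rw [one_mul]; exact (norm_ambiguityL2 f g).le)

@[simp] theorem ambiguityCLM_apply (f g : L2 ι) : ambiguityCLM f g = ambiguityL2 f g := rfl

/-- With a normalised window, `f ↦ A(f,φ)` is a linear isometry, and isometries preserve inner
products. -/
theorem ip_ambiguityL2 {φ : L2 ι} (hφ : ‖φ‖ = 1) (f h : L2 ι) :
    ip (ambiguityL2 f φ) (ambiguityL2 h φ) = ip f h := by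
  let A : L2 ι →ₗᵢ[ℂ] L2 (ι ⊕ ι) :=
    { toFun := fun f => ambiguityL2 f φ
      map_add' := fun f f' => by simp only [← ambiguityCLM_apply, map_add]; rfl
      map_smul' := fun c f => by simp only [← ambiguityCLM_apply, map_smul]; rfl
      norm_map' := fun f => by
        change ‖ambiguityL2 f φ‖ = ‖f‖
        rw [norm_ambiguityL2, hφ, mul_one] }
  exact A.inner_map_map h f

/-- Moyal's identity: `⟨f, h⟩ = ∫ A(f, φ)(u) ⟨ρ(u) φ, h⟩ du` for a normalised window `φ`. -/
theorem ip_eq_integral_ambiguity {φ : L2 ι} (hφ : ‖φ‖ = 1) (f h : L2 ι) :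
    ip f h = ∫ u, ambiguity f φ u * ip (symShift u φ) h := by
  rw [← ip_ambiguityL2 hφ, ip_eq_integral]
  refine integral_congr_ae ?_
  filter_upwards [coeFn_ambiguityL2 f φ, coeFn_ambiguityL2 h φ] with z h1 h2
  rw [h1, h2, ambiguity_eq h, conj_ip]

/-! ### Gaussians -/

/-- The Gaussian `t ↦ exp(-π a |t|²)`. -/
def scaledGaussian (a : ℝ) (t : E ι) : ℂ := Complex.exp (-(Real.pi * a) * (‖t‖ : ℂ) ^ 2)

theorem continuous_scaledGaussian (a : ℝ) : Continuous (scaledGaussian (ι := ι) a) := by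
  unfold scaledGaussian
  fun_prop

theorem integrable_scaledGaussian {a : ℝ} (ha : 0 < a) :
    Integrable (scaledGaussian (ι := ι) a) volume := by
  have h := GaussianFourier.integrable_cexp_neg_mul_sq_norm_add (V := E ι)
    (b := ((Real.pi * a : ℝ) : ℂ)) (by simpa using mul_pos Real.pi_pos ha) 0 0
  refine h.congr (Eventually.of_forall fun t => ?_)
  simp [scaledGaussian]

theorem norm_scaledGaussian (a : ℝ) (t : E ι) :
    ‖scaledGaussian a t‖ = Real.exp (-(Real.pi * a) * ‖t‖ ^ 2) := by
  rw [scaledGaussian, Complex.norm_exp]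
  congr 1
  norm_cast

theorem memLp_scaledGaussian {a : ℝ} (ha : 0 < a) :
    MemLp (scaledGaussian (ι := ι) a) 2 volume := by
  rw [memLp_two_iff_integrable_sq_norm (continuous_scaledGaussian a).aestronglyMeasurable]
  refine (integrable_scaledGaussian (ι := ι) (a := 2 * a) (by positivity)).norm.congr
    (Eventually.of_forall fun t => ?_)
  simp only [norm_scaledGaussian, ← Real.exp_nat_mul]
  congr 1
  push_cast
  ring

/-- The Gaussian `t ↦ exp(-π a |t|²)` as an element of `L²`. -/
def scaledGaussianL2 {a : ℝ} (ha : 0 < a) : L2 ι := (memLp_scaledGaussian ha).toLp _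

theorem coeFn_scaledGaussianL2 {a : ℝ} (ha : 0 < a) :
    (scaledGaussianL2 ha : E ι → ℂ) =ᵐ[volume] scaledGaussian a :=
  (memLp_scaledGaussian ha).coeFn_toLp

theorem gaussianFun_eq (t : E ι) :
    gaussianFun t = ((2 : ℝ) ^ ((Fintype.card ι : ℝ) / 4) : ℝ) * scaledGaussian 1 t := by
  rw [gaussianFun, scaledGaussian]
  push_cast
  ring_nf

theorem coeFn_gaussian : (gaussian : E ι → ℂ) =ᵐ[volume] gaussianFun :=
  memLp_gaussianFun.coeFn_toLp

theorem gaussian_eq : (gaussian : L2 ι) =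
    (((2 : ℝ) ^ ((Fintype.card ι : ℝ) / 4) : ℝ) : ℂ) • scaledGaussianL2 one_pos := by
  apply Lp.ext
  filter_upwards [coeFn_gaussian (ι := ι), coeFn_scaledGaussianL2 (ι := ι) one_pos,
    Lp.coeFn_smul (((2 : ℝ) ^ ((Fintype.card ι : ℝ) / 4) : ℝ) : ℂ)
      (scaledGaussianL2 one_pos : L2 ι)] with t h1 h2 h3
  rw [h1, h3, Pi.smul_apply, h2, gaussianFun_eq, smul_eq_mul]

theorem ambiguity_scaledGaussian {a : ℝ} (ha : 0 < a) (z : E (ι ⊕ ι)) :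
    ambiguity (scaledGaussianL2 ha) (scaledGaussianL2 one_pos) z =
      (1 / ((a : ℂ) + 1)) ^ ((Fintype.card ι : ℂ) / 2) *
        Complex.exp (-(Real.pi * (a / (a + 1))) * (‖pos z‖ : ℂ) ^ 2
          - Real.pi / (a + 1) * (‖freq z‖ : ℂ) ^ 2
          - Real.pi * Complex.I * ((1 - a) / (1 + a)) *
            ((inner ℝ (freq z) (pos z) : ℝ) : ℂ)) := by
  have ha1 : (0 : ℝ) < a + 1 := by positivity
  have ha1' : (a : ℂ) + 1 ≠ 0 := by exact_mod_cast ha1.ne'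
  have hpi : (Real.pi : ℂ) ≠ 0 := by exact_mod_cast Real.pi_ne_zero
  set x := pos z
  set ω := freq z
  have h1 : ambiguity (scaledGaussianL2 ha) (scaledGaussianL2 one_pos) z =
      ∫ t : E ι, scaledGaussian a t * starRingEnd ℂ
        (Complex.exp (Real.pi * Complex.I * ((inner ℝ ω ((2 : ℝ) • t - x) : ℝ) : ℂ)) *
          scaledGaussian 1 (t - x)) := by
    rw [ambiguity_eq, ip_eq_integral]
    refine integral_congr_ae ?_
    filter_upwards [coeFn_scaledGaussianL2 (ι := ι) ha, coeFn_symShift z (scaledGaussianL2 one_pos),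
      (measurePreserving_sub x).quasiMeasurePreserving.ae
        (coeFn_scaledGaussianL2 (ι := ι) one_pos)] with t h1 h2 h3
    rw [h1, h2, h3]
  -- Completing the square: `x/(a+1)` is the centre of the product of the Gaussians `exp(-πa|t|²)`
  -- and `exp(-π|t-x|²)`.
  rw [h1, ← integral_add_right_eq_self _ ((1 / (a + 1)) • x)]
  have h2 : ∀ s : E ι, scaledGaussian a (s + (1 / (a + 1)) • x) * starRingEnd ℂ
        (Complex.exp (Real.pi * Complex.I *
          ((inner ℝ ω ((2 : ℝ) • (s + (1 / (a + 1)) • x) - x) : ℝ) : ℂ)) *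
          scaledGaussian 1 (s + (1 / (a + 1)) • x - x)) =
      Complex.exp (-((Real.pi * (a + 1) : ℝ) : ℂ) * (‖s‖ : ℂ) ^ 2 +
        (-(2 * Real.pi * Complex.I)) * ((inner ℝ ω s : ℝ) : ℂ)) *
      Complex.exp (-(Real.pi * (a / (a + 1))) * (‖x‖ : ℂ) ^ 2
          - Real.pi * Complex.I * ((1 - a) / (1 + a)) * ((inner ℝ ω x : ℝ) : ℂ)) := by
    intro s
    have e1 : s + (1 / (a + 1)) • x - x = s - (a / (a + 1)) • x := by
      rw [add_sub_assoc, sub_eq_add_neg s, ← neg_smul]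
      congr 1
      nth_rewrite 2 [← one_smul ℝ x]
      rw [← sub_smul]
      congr 1
      field_simp
      ring
    have e2 : (‖s + (1 / (a + 1)) • x‖ : ℂ) ^ 2 =
        (‖s‖ : ℂ) ^ 2 + 2 * ((1 / (a + 1)) * ((inner ℝ s x : ℝ) : ℂ))
          + (1 / (a + 1)) ^ 2 * (‖x‖ : ℂ) ^ 2 := by
      have := norm_add_sq_real s ((1 / (a + 1)) • x)
      rw [norm_smul, inner_smul_right, mul_pow, Real.norm_eq_abs, sq_abs] at this
      exact_mod_cast this
    have e3 : (‖s - (a / (a + 1)) • x‖ : ℂ) ^ 2 =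
        (‖s‖ : ℂ) ^ 2 - 2 * ((a / (a + 1)) * ((inner ℝ s x : ℝ) : ℂ))
          + (a / (a + 1)) ^ 2 * (‖x‖ : ℂ) ^ 2 := by
      have := norm_sub_sq_real s ((a / (a + 1)) • x)
      rw [norm_smul, inner_smul_right, mul_pow, Real.norm_eq_abs, sq_abs] at this
      exact_mod_cast this
    have e4 : starRingEnd ℂ (scaledGaussian 1 (s - (a / (a + 1)) • x)) =
        scaledGaussian 1 (s - (a / (a + 1)) • x) := by
      rw [scaledGaussian, ← Complex.exp_conj]
      simp
    rw [map_mul, conj_exp_pi_I_mul, e1, e4, scaledGaussian, scaledGaussian, e2, e3,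
      ← Complex.exp_add, ← Complex.exp_add, ← Complex.exp_add]
    congr 1
    simp only [inner_sub_right, inner_smul_right, inner_add_right]
    have ha2' : (1 : ℂ) + a ≠ 0 := by rwa [add_comm]
    push_cast
    field_simp
    ring
  simp_rw [h2]
  rw [integral_mul_const, GaussianFourier.integral_cexp_neg_mul_sq_norm_add
    (by simpa using mul_pos Real.pi_pos ha1), mul_assoc, ← Complex.exp_add]
  congr 1
  · rw [finrank_euclideanSpace]
    congr 1
    push_cast
    field_simp
  · congr 1
    push_cast
    rw [neg_sq, mul_pow, Complex.I_sq]
    field_simp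
    ring

theorem gaussian_scale_mul (n : ℕ) :
    ((((2 : ℝ) ^ ((n : ℝ) / 4) : ℝ) : ℂ) * (((2 : ℝ) ^ ((n : ℝ) / 4) : ℝ) : ℂ)) *
      (1 / (((1 : ℝ) : ℂ) + 1)) ^ ((n : ℂ) / 2) = 1 := by
  have h : (1 / (((1 : ℝ) : ℂ) + 1)) ^ ((n : ℂ) / 2) =
      (((2 : ℝ)⁻¹ ^ ((n : ℝ) / 2) : ℝ) : ℂ) := by
    rw [Complex.ofReal_cpow (by norm_num)]
    push_cast
    norm_num
  rw [h, ← Complex.ofReal_mul, ← Complex.ofReal_mul, ← Real.rpow_add two_pos,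
    Real.inv_rpow two_pos.le, show (n : ℝ) / 4 + n / 4 = n / 2 by ring,
    mul_inv_cancel₀ (by positivity), Complex.ofReal_one]

theorem ambiguity_gaussian (z : E (ι ⊕ ι)) :
    ambiguity gaussian gaussian z = scaledGaussian (1 / 2) z := by
  rw [gaussian_eq, ambiguity_smul_left, ambiguity_smul_right, Pi.smul_apply, Pi.smul_apply,
    smul_eq_mul, smul_eq_mul, Complex.conj_ofReal, ambiguity_scaledGaussian, ← mul_assoc,
    ← mul_assoc, gaussian_scale_mul, one_mul, scaledGaussian]
  congr 1
  have h : (‖z‖ : ℂ) ^ 2 = (‖pos z‖ : ℂ) ^ 2 + (‖freq z‖ : ℂ) ^ 2 := by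
    exact_mod_cast norm_sq_eq_pos_add_freq z
  rw [h]
  push_cast
  ring

theorem ambiguityL2_gaussian :
    ambiguityL2 (gaussian : L2 ι) gaussian = scaledGaussianL2 (a := 1 / 2) (by norm_num) := by
  apply Lp.ext
  filter_upwards [coeFn_ambiguityL2 (gaussian : L2 ι) gaussian,
    coeFn_scaledGaussianL2 (ι := ι ⊕ ι) (a := 1 / 2) (by norm_num)] with z h1 h2
  rw [h1, h2, ambiguity_gaussian]

/-- The value of `A(φ₀,φ₀)` at the origin is `‖φ₀‖²`. -/
theorem norm_gaussian : ‖(gaussian : L2 ι)‖ = 1 := by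
  have h := ambiguity_gaussian (0 : E (ι ⊕ ι))
  rw [ambiguity_eq, symShift_zero, ip, inner_self_eq_norm_sq_to_K] at h
  have h' : ‖(gaussian : L2 ι)‖ ^ 2 = 1 := by
    have : ((‖(gaussian : L2 ι)‖ ^ 2 : ℝ) : ℂ) = 1 := by
      push_cast
      simpa [scaledGaussian] using h
    exact_mod_cast this
  exact (pow_eq_one_iff_of_nonneg (norm_nonneg _) two_ne_zero).1 h'

theorem parity_gaussian : parity (gaussian : L2 ι) = gaussian := by
  apply Lp.ext
  filter_upwards [coeFn_parity (gaussian : L2 ι), coeFn_gaussian (ι := ι),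
    measurePreserving_neg.quasiMeasurePreserving.ae (coeFn_gaussian (ι := ι))] with t h1 h2 h3
  rw [h1, h2, h3, gaussianFun, gaussianFun, norm_neg]

/-- Puts every Gaussian in `M¹`; besides `a = 1`, the values `a = 1/2` (for `A(φ₀,φ₀)`) and `a = 4`
(for the dilated window) are used. -/
theorem integrable_ambiguity_scaledGaussian {a : ℝ} (ha : 0 < a) :
    Integrable (ambiguity (scaledGaussianL2 ha : L2 ι) gaussian) volume := by
  rw [gaussian_eq, ambiguity_smul_right]
  refine Integrable.smul _ ?_
  -- The decay rates in position and frequency differ; the smaller one gives a radial majorant, the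
  -- cross term being purely imaginary.
  set m : ℝ := min (a / (a + 1)) (1 / (a + 1)) with hm
  have hm0 : 0 < m := lt_min (by positivity) (by positivity)
  refine Integrable.mono' ((integrable_scaledGaussian (ι := ι ⊕ ι) hm0).norm.const_mul
    ‖(1 / ((a : ℂ) + 1)) ^ ((Fintype.card ι : ℂ) / 2)‖)
    (continuous_ambiguity _ _).aestronglyMeasurable (Eventually.of_forall fun z => ?_)
  rw [ambiguity_scaledGaussian, norm_mul, norm_scaledGaussian, Complex.norm_exp]
  gcongr
  have h : (-(Real.pi * (a / (a + 1))) * (‖pos z‖ : ℂ) ^ 2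
          - Real.pi / (a + 1) * (‖freq z‖ : ℂ) ^ 2
          - Real.pi * Complex.I * ((1 - a) / (1 + a)) * ((inner ℝ (freq z) (pos z) : ℝ) : ℂ)) =
      ((-(Real.pi * (a / (a + 1))) * ‖pos z‖ ^ 2 - Real.pi / (a + 1) * ‖freq z‖ ^ 2 : ℝ) : ℂ)
        + ((-(Real.pi * ((1 - a) / (1 + a)) * inner ℝ (freq z) (pos z)) : ℝ) : ℂ) * Complex.I := by
    push_cast; ring
  rw [h, Complex.add_re, Complex.re_ofReal_mul, Complex.I_re, mul_zero, add_zero,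
    Complex.ofReal_re, norm_sq_eq_pos_add_freq]
  have h1 : m * ‖pos z‖ ^ 2 ≤ a / (a + 1) * ‖pos z‖ ^ 2 := by gcongr; exact min_le_left _ _
  have h2 : m * ‖freq z‖ ^ 2 ≤ 1 / (a + 1) * ‖freq z‖ ^ 2 := by gcongr; exact min_le_right _ _
  have h3 := mul_le_mul_of_nonneg_left (add_le_add h1 h2) Real.pi_pos.le
  calc _ = -(Real.pi * (a / (a + 1) * ‖pos z‖ ^ 2 + 1 / (a + 1) * ‖freq z‖ ^ 2)) := by ring
    _ ≤ -(Real.pi * (m * ‖pos z‖ ^ 2 + m * ‖freq z‖ ^ 2)) := neg_le_neg h3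
    _ = _ := by ring

/-- A vector `f` orthogonal to all atoms has `A(f,φ₀) = 0`, and `‖A(f,φ₀)‖ = ‖f‖`. -/
theorem dense_span_symShift_gaussian :
    Dense (Submodule.span ℂ (Set.range fun u : E (ι ⊕ ι) => symShift u (gaussian : L2 ι)) :
      Set (L2 ι)) := by
  rw [Submodule.dense_iff_topologicalClosure_eq_top, Submodule.topologicalClosure_eq_top_iff,
    Submodule.eq_bot_iff]
  intro f hf
  rw [← norm_eq_zero, ← mul_one ‖f‖, ← norm_gaussian (ι := ι), ← norm_ambiguityL2, norm_eq_zero,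
    Lp.eq_zero_iff_ae_eq_zero]
  filter_upwards [coeFn_ambiguityL2 f gaussian] with z hz
  rw [hz, ambiguity_eq]
  exact (Submodule.mem_orthogonal _ f).1 hf _ (Submodule.subset_span ⟨z, rfl⟩)

/-! ### Covariance of the ambiguity function -/

theorem ambiguity_symShift_left (u : E (ι ⊕ ι)) (f g : L2 ι) (z : E (ι ⊕ ι)) :
    ambiguity (symShift u f) g z =
      Complex.exp (Real.pi * Complex.I * (sympl u z : ℂ)) * ambiguity f g (z - u) := by
  have h := ip_symShift_right (-u) f (symShift z g)
  rw [neg_neg] at h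
  rw [ambiguity_eq, ambiguity_eq, ← h, symShift_symShift, ip_smul_right, conj_exp_pi_I_mul,
    neg_add_eq_sub, sympl, sympl]
  simp only [pos_neg, freq_neg, inner_neg_right, inner_neg_left]
  congr 2
  push_cast; ring

theorem ambiguity_symShift_right (v : E (ι ⊕ ι)) (f g : L2 ι) (z : E (ι ⊕ ι)) :
    ambiguity f (symShift v g) z =
      Complex.exp (Real.pi * Complex.I * (sympl v z : ℂ)) * ambiguity f g (z + v) := by
  rw [ambiguity_eq, ambiguity_eq, symShift_symShift, ip_smul_right, conj_exp_pi_I_mul, sympl,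
    sympl]
  congr 2
  push_cast; ring

/-- Covariance: shifting both arguments acts on the ambiguity function by one symmetric shift on the
doubled phase space, so its `M¹` norm does not depend on `u` and `v`. -/
theorem ambiguityL2_symShift (u v : E (ι ⊕ ι)) (f g : L2 ι) :
    ambiguityL2 (symShift u f) (symShift v g) =
      symShift (point (u - v) ((1 / 2 : ℝ) • rotation (u + v))) (ambiguityL2 f g) := by
  apply Lp.ext
  filter_upwards [coeFn_ambiguityL2 (symShift u f) (symShift v g),
    coeFn_symShift (point (u - v) ((1 / 2 : ℝ) • rotation (u + v))) (ambiguityL2 f g),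
    (measurePreserving_sub (u - v)).quasiMeasurePreserving.ae (coeFn_ambiguityL2 f g)]
    with z h1 h2 h3
  rw [h1, h2, pos_point, freq_point, h3, ambiguity_symShift_left, ambiguity_symShift_right,
    ← mul_assoc, ← Complex.exp_add, sub_add]
  congr 2
  rw [inner_smul_left, real_inner_comm, ← sympl_eq_inner_rotation]
  simp only [sympl, pos_add, freq_add, pos_sub, freq_sub, pos_smul, freq_smul, inner_sub_left,
    inner_sub_right, inner_add_left, inner_add_right, inner_smul_left, inner_smul_right]
  simp only [conj_trivial]
  push_cast; ring

/-! ### The `M¹` norm with values in `[0, ∞]` -/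

/-- The norm `‖V_{φ₀} f‖_{L¹} ∈ [0, ∞]` of `f ∈ L²`. -/
def m1Norm (f : L2 ι) : ℝ≥0∞ := ∫⁻ z, ‖ambiguity f gaussian z‖ₑ

theorem enorm_ambiguity (f g : L2 ι) (z : E (ι ⊕ ι)) : ‖ambiguity f g z‖ₑ = ‖stft g f z‖ₑ := by
  rw [← ofReal_norm, ← ofReal_norm, norm_ambiguity]

theorem m1Norm_lt_top_iff (f : L2 ι) : m1Norm f < ∞ ↔ f ∈ feichtinger ι := by
  change _ ↔ Integrable (stft gaussian f) volume
  simp only [m1Norm, enorm_ambiguity]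
  exact ⟨fun h => ⟨(continuous_stft _ _).aestronglyMeasurable, h⟩, fun h => h.2⟩

theorem M1.m1Norm_eq (f : M1 ι) : m1Norm (f : L2 ι) = ENNReal.ofReal ‖f‖ := by
  rw [M1.norm_def, ofReal_integral_norm_eq_lintegral_enorm f.integrable]
  simp only [m1Norm, enorm_ambiguity]

theorem M1.m1Norm_lt_top (f : M1 ι) : m1Norm (f : L2 ι) < ∞ := by
  rw [M1.m1Norm_eq]; exact ENNReal.ofReal_lt_top

theorem lintegral_enorm_ambiguity_symShift_left (u : E (ι ⊕ ι)) (f g : L2 ι) :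
    ∫⁻ z, ‖ambiguity (symShift u f) g z‖ₑ = ∫⁻ z, ‖ambiguity f g z‖ₑ := by
  rw [← lintegral_sub_right_eq_self (fun z => ‖ambiguity f g z‖ₑ) u]
  refine lintegral_congr fun z => ?_
  rw [ambiguity_symShift_left, enorm_mul, ← ofReal_norm, norm_exp_pi_I_mul]
  simp

theorem m1Norm_symShift (u : E (ι ⊕ ι)) (f : L2 ι) : m1Norm (symShift u f) = m1Norm f :=
  lintegral_enorm_ambiguity_symShift_left u f gaussian

theorem m1Norm_smul (c : ℂ) (f : L2 ι) : m1Norm (c • f) = ‖c‖ₑ * m1Norm f := by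
  rw [m1Norm, m1Norm, ← lintegral_const_mul _ (continuous_ambiguity _ _).measurable.enorm]
  refine lintegral_congr fun z => ?_
  rw [ambiguity_smul_left, Pi.smul_apply, enorm_smul]

theorem m1Norm_scaledGaussianL2_lt_top {a : ℝ} (ha : 0 < a) :
    m1Norm (scaledGaussianL2 ha : L2 ι) < ∞ :=
  (integrable_ambiguity_scaledGaussian ha).2

theorem m1Norm_gaussian_lt_top : m1Norm (gaussian : L2 ι) < ∞ := by
  rw [gaussian_eq, m1Norm_smul]
  exact ENNReal.mul_lt_top (by simp) (m1Norm_scaledGaussianL2_lt_top one_pos)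

/-- Interpolation: `‖f‖² = ∫|A(f,φ₀)|²` is at most the supremum of `|A(f,φ₀)|`, which is at most
`‖f‖`, times its integral. -/
theorem enorm_le_m1Norm (f : L2 ι) : ‖f‖ₑ ≤ m1Norm f := by
  have h : ‖f‖ₑ ^ 2 ≤ ‖f‖ₑ * m1Norm f := by
    have h1 := lintegral_enorm_sq_ambiguity f (gaussian : L2 ι)
    have hg : ‖(gaussian : L2 ι)‖ₑ = 1 := by rw [← ofReal_norm, norm_gaussian, ENNReal.ofReal_one]
    rw [hg, one_pow, mul_one] at h1
    rw [← h1, m1Norm, ← lintegral_const_mul _ (continuous_ambiguity _ _).measurable.enorm]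
    refine lintegral_mono fun z => ?_
    rw [sq]
    gcongr
    rw [← ofReal_norm, ← ofReal_norm]
    refine ENNReal.ofReal_le_ofReal ?_
    rw [ambiguity_eq]
    refine (norm_ip_le _ _).trans_eq ?_
    rw [norm_symShift, norm_gaussian, mul_one]
  rw [sq] at h
  by_cases h0 : ‖f‖ₑ = 0
  · rw [h0]; exact zero_le
  · exact (ENNReal.mul_le_mul_iff_right h0 (by simp)).1 h

theorem M1.norm_toL2_le (f : M1 ι) : ‖(f : L2 ι)‖ ≤ ‖f‖ := by
  have h := enorm_le_m1Norm (f : L2 ι)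
  rw [M1.m1Norm_eq, ← ofReal_norm] at h
  exact (ENNReal.ofReal_le_ofReal_iff (norm_nonneg f)).1 h

/-- To bound `∫ |⟨f, k(x)⟩| dx` by the `M¹` norm of `f`, it suffices to do so for the
time-frequency shifts of the Gaussian. -/
theorem lintegral_enorm_ip_le (k : E κ → L2 ι)
    (hk : Continuous fun p : E κ × E (ι ⊕ ι) => ip (symShift p.2 gaussian) (k p.1))
    {C : ℝ≥0∞} (hC : ∀ u, ∫⁻ x, ‖ip (symShift u gaussian) (k x)‖ₑ ≤ C) (f : L2 ι) :
    ∫⁻ x, ‖ip f (k x)‖ₑ ≤ m1Norm f * C := by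
  have hA : Measurable (ambiguity f gaussian) := (continuous_ambiguity _ _).measurable
  have hm : Measurable fun p : E κ × E (ι ⊕ ι) => ‖ip (symShift p.2 gaussian) (k p.1)‖ₑ :=
    hk.measurable.enorm
  have hmu (u : E (ι ⊕ ι)) : Measurable fun x => ‖ip (symShift u gaussian) (k x)‖ₑ :=
    Measurable.comp (g := fun p : E κ × E (ι ⊕ ι) => ‖ip (symShift p.2 gaussian) (k p.1)‖ₑ)
      (f := fun x => (x, u)) hm measurable_prodMk_right
  have hm' : AEMeasurable (Function.uncurry fun (x : E κ) (u : E (ι ⊕ ι)) =>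
      ‖ambiguity f gaussian u‖ₑ * ‖ip (symShift u gaussian) (k x)‖ₑ) (volume.prod volume) :=
    Measurable.aemeasurable (Measurable.mul (hA.enorm.comp measurable_snd) hm)
  calc ∫⁻ x, ‖ip f (k x)‖ₑ
      ≤ ∫⁻ x, ∫⁻ u, ‖ambiguity f gaussian u‖ₑ * ‖ip (symShift u gaussian) (k x)‖ₑ := by
        refine lintegral_mono fun x => ?_
        -- Moyal's identity expands `f` in atoms with weight `A(f,φ₀)`.
        rw [ip_eq_integral_ambiguity norm_gaussian]
        refine (enorm_integral_le_lintegral_enorm _).trans_eq ?_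
        simp only [enorm_mul]
    _ = ∫⁻ u, ∫⁻ x, ‖ambiguity f gaussian u‖ₑ * ‖ip (symShift u gaussian) (k x)‖ₑ :=
        lintegral_lintegral_swap hm'
    _ ≤ ∫⁻ u, ‖ambiguity f gaussian u‖ₑ * C := by
        refine lintegral_mono fun u => ?_
        rw [lintegral_const_mul _ (hmu u)]
        gcongr
        exact hC u
    _ = m1Norm f * C := by rw [lintegral_mul_const _ hA.enorm, m1Norm]

theorem enorm_ip_comm (f g : L2 ι) : ‖ip f g‖ₑ = ‖ip g f‖ₑ := by
  rw [← conj_ip, RCLike.enorm_conj]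

/-- The adjoint moves `T` onto the analysing window, which reduces the claim to the atomic bound
`lintegral_enorm_ip_le`. -/
theorem m1Norm_map_le (T : L2 ι →L[ℂ] L2 κ) {C : ℝ≥0∞}
    (hC : ∀ u, m1Norm (T (symShift u gaussian)) ≤ C) (f : L2 ι) :
    m1Norm (T f) ≤ m1Norm f * C := by
  have h : ∀ g z, ip g (ContinuousLinearMap.adjoint T (symShift z gaussian)) =
      ambiguity (T g) gaussian z := fun g z => by
    rw [ambiguity_eq, ip, ContinuousLinearMap.adjoint_inner_left, ip]
  simp only [m1Norm, ← h] at hC ⊢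
  refine lintegral_enorm_ip_le _ ?_ hC f
  exact Continuous.inner
    ((ContinuousLinearMap.adjoint T).continuous.comp
      ((continuous_symShift_apply _).comp continuous_fst))
    ((continuous_symShift_apply _).comp continuous_snd)

/-- The Riesz representation plays the role of the adjoint for an antilinear map. -/
theorem exists_ip_eq_of_conjLinear (T : L2 ι →L⋆[ℂ] L2 κ) (h : L2 κ) :
    ∃ k : L2 ι, ∀ f, ip f k = ip h (T f) := by
  let ℓ : L2 ι →L[ℂ] ℂ := LinearMap.mkContinuous
    { toFun := fun f => ip h (T f)
      map_add' := fun f g => by rw [map_add, ip_add_right]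
      map_smul' := fun c f => by
        rw [map_smulₛₗ, ip_smul_right, Complex.conj_conj, RingHom.id_apply, smul_eq_mul] }
    (‖h‖ * ‖T‖) fun f => by
      refine (norm_ip_le _ _).trans ?_
      rw [mul_assoc]
      gcongr
      exact T.le_opNorm f
  exact ⟨(InnerProductSpace.toDual ℂ (L2 ι)).symm ℓ, fun f =>
    InnerProductSpace.toDual_symm_apply⟩

theorem m1Norm_map_conjLinear_le (T : L2 ι →L⋆[ℂ] L2 κ) {C : ℝ≥0∞}
    (hC : ∀ u, m1Norm (T (symShift u gaussian)) ≤ C) (f : L2 ι) :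
    m1Norm (T f) ≤ m1Norm f * C := by
  choose k hk using fun z : E (κ ⊕ κ) => exists_ip_eq_of_conjLinear T (symShift z gaussian)
  have h : ∀ g z, ‖ambiguity (T g) gaussian z‖ₑ = ‖ip g (k z)‖ₑ := fun g z => by
    rw [ambiguity_eq, hk, enorm_ip_comm]
  simp only [m1Norm, h] at hC ⊢
  refine lintegral_enorm_ip_le k ?_ hC f
  simp only [hk]
  exact Continuous.inner
    (T.continuous.comp ((continuous_symShift_apply _).comp continuous_snd))
    ((continuous_symShift_apply _).comp continuous_fst)

theorem lintegral_enorm_ambiguity_le (f g : L2 ι) :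
    ∫⁻ z, ‖ambiguity f g z‖ₑ ≤ m1Norm f * m1Norm g := by
  simp only [ambiguity_eq]
  refine lintegral_enorm_ip_le _ ?_ (fun u => ?_) f
  · exact Continuous.inner ((continuous_symShift_apply _).comp continuous_fst)
      ((continuous_symShift_apply _).comp continuous_snd)
  · simp only [← ambiguity_eq]
    rw [lintegral_enorm_ambiguity_symShift_left, m1Norm,
      ← lintegral_neg_eq_self (fun z => ‖ambiguity g gaussian z‖ₑ)]
    refine (lintegral_congr fun z => ?_).le
    rw [← ambiguity_conj_symm, RCLike.enorm_conj]

theorem integrable_ambiguity (f g : M1 ι) :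
    Integrable (ambiguity (f : L2 ι) (g : L2 ι)) volume :=
  ⟨(continuous_ambiguity _ _).aestronglyMeasurable,
    (lintegral_enorm_ambiguity_le _ _).trans_lt
      (ENNReal.mul_lt_top f.m1Norm_lt_top g.m1Norm_lt_top)⟩

/-- The atomic criterion is applied in the linear argument and then in the antilinear one;
covariance makes the bound on pairs of atoms uniform. -/
theorem m1Norm_ambiguityL2_le (f g : L2 ι) :
    m1Norm (ambiguityL2 f g) ≤
      m1Norm f * (m1Norm g * m1Norm (ambiguityL2 (gaussian : L2 ι) gaussian)) := by
  refine m1Norm_map_le ((ContinuousLinearMap.apply' (L2 (ι ⊕ ι)) (starRingEnd ℂ) g).comp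
    ambiguityCLM) (fun u => ?_) f
  refine m1Norm_map_conjLinear_le (ambiguityCLM (symShift u gaussian)) (fun v => ?_) g
  rw [ambiguityCLM_apply, ambiguityL2_symShift, m1Norm_symShift]

/-! ### Dilation -/

theorem lintegral_comp_two_smul (F : E ι → ℝ≥0∞) (hF : Measurable F) :
    ∫⁻ t, F ((2 : ℝ) • t) = ((2 : ℝ≥0∞) ^ Fintype.card ι)⁻¹ * ∫⁻ t, F t := by
  rw [← lintegral_map hF (measurable_const_smul (2 : ℝ)),
    Measure.map_addHaar_smul volume two_ne_zero, lintegral_smul_measure, finrank_euclideanSpace,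
    smul_eq_mul, abs_of_pos (by positivity), ENNReal.ofReal_inv_of_pos (by positivity),
    ENNReal.ofReal_pow two_pos.le]
  simp

theorem quasiMeasurePreserving_two_smul :
    Measure.QuasiMeasurePreserving (fun t : E ι => (2 : ℝ) • t) volume volume := by
  refine ⟨measurable_const_smul (2 : ℝ), ?_⟩
  rw [Measure.map_addHaar_smul volume two_ne_zero]
  exact Measure.smul_absolutelyContinuous

theorem lintegral_enorm_sq_two_smul_le (f : L2 ι) :
    ∫⁻ t, ‖f ((2 : ℝ) • t)‖ₑ ^ 2 ≤ ‖f‖ₑ ^ 2 := by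
  have hf : Measurable (f : E ι → ℂ) := (Lp.stronglyMeasurable f).measurable
  rw [lintegral_comp_two_smul (fun t => ‖f t‖ₑ ^ 2) (by fun_prop), lintegral_enorm_sq_coeFn]
  refine mul_le_of_le_one_left zero_le (ENNReal.inv_le_one.2 ?_)
  exact one_le_pow₀ one_le_two

theorem memLp_two_smul (f : L2 ι) : MemLp (fun t => f ((2 : ℝ) • t)) 2 volume := by
  refine ⟨((Lp.stronglyMeasurable f).comp_measurable
    (measurable_const_smul (2 : ℝ))).aestronglyMeasurable, ?_⟩
  rw [eLpNorm_lt_top_iff_lintegral_rpow_enorm_lt_top two_ne_zero ENNReal.ofNat_ne_top]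
  simp only [ENNReal.toReal_ofNat, ENNReal.rpow_ofNat]
  exact (lintegral_enorm_sq_two_smul_le f).trans_lt (by simp)

/-- The dilation `f ↦ f(2 ·)` on `L²`. -/
def dilation : BoundedOp ι :=
  LinearMap.mkContinuous
    { toFun := fun f => (memLp_two_smul f).toLp _
      map_add' := fun f g => by
        apply Lp.ext
        filter_upwards [(memLp_two_smul (f + g)).coeFn_toLp, (memLp_two_smul f).coeFn_toLp,
          (memLp_two_smul g).coeFn_toLp, quasiMeasurePreserving_two_smul.ae (Lp.coeFn_add f g),
          Lp.coeFn_add ((memLp_two_smul f).toLp _) ((memLp_two_smul g).toLp _)]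
          with t h1 h2 h3 h4 h5
        rw [h1, h5, Pi.add_apply, h2, h3, h4, Pi.add_apply]
      map_smul' := fun c f => by
        apply Lp.ext
        filter_upwards [(memLp_two_smul (c • f)).coeFn_toLp, (memLp_two_smul f).coeFn_toLp,
          quasiMeasurePreserving_two_smul.ae (Lp.coeFn_smul c f),
          Lp.coeFn_smul c ((memLp_two_smul f).toLp _)] with t h1 h2 h3 h4
        rw [h1, RingHom.id_apply, h4, Pi.smul_apply, h2, h3, Pi.smul_apply] }
    1 fun f => by
      simp only [LinearMap.coe_mk, AddHom.coe_mk, one_mul]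
      have h : ‖(memLp_two_smul f).toLp _‖ₑ ^ 2 ≤ ‖f‖ₑ ^ 2 := by
        rw [← lintegral_enorm_sq_coeFn]
        refine (lintegral_congr_ae ?_).trans_le (lintegral_enorm_sq_two_smul_le f)
        filter_upwards [(memLp_two_smul f).coeFn_toLp] with t h1
        rw [h1]
      have h' := (ENNReal.pow_le_pow_left_iff two_ne_zero).1 h
      rwa [← ofReal_norm, ← ofReal_norm, ENNReal.ofReal_le_ofReal_iff (norm_nonneg _)] at h'

theorem coeFn_dilation (f : L2 ι) :
    (dilation f : E ι → ℂ) =ᵐ[volume] fun t => f ((2 : ℝ) • t) :=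
  (memLp_two_smul f).coeFn_toLp

theorem dilation_symShift (z : E (ι ⊕ ι)) (f : L2 ι) :
    dilation (symShift z f) =
      symShift (point ((1 / 2 : ℝ) • pos z) ((2 : ℝ) • freq z)) (dilation f) := by
  apply Lp.ext
  filter_upwards [coeFn_dilation (symShift z f),
    coeFn_symShift (point ((1 / 2 : ℝ) • pos z) ((2 : ℝ) • freq z)) (dilation f),
    quasiMeasurePreserving_two_smul.ae (coeFn_symShift z f),
    (measurePreserving_sub ((1 / 2 : ℝ) • pos z)).quasiMeasurePreserving.ae (coeFn_dilation f)]
    with t h1 h2 h3 h4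
  rw [h1, h2, h3, pos_point, freq_point, h4]
  congr 1
  · simp only [inner_sub_right, inner_smul_right, inner_smul_left, conj_trivial]
    congr 3
    ring
  · rw [smul_sub, smul_smul]
    norm_num

theorem dilation_gaussian :
    dilation (gaussian : L2 ι) =
      (((2 : ℝ) ^ ((Fintype.card ι : ℝ) / 4) : ℝ) : ℂ) • scaledGaussianL2 (a := 4) four_pos := by
  apply Lp.ext
  filter_upwards [coeFn_dilation (gaussian : L2 ι),
    quasiMeasurePreserving_two_smul.ae (coeFn_gaussian (ι := ι)),
    coeFn_scaledGaussianL2 (ι := ι) four_pos,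
    Lp.coeFn_smul (((2 : ℝ) ^ ((Fintype.card ι : ℝ) / 4) : ℝ) : ℂ)
      (scaledGaussianL2 four_pos : L2 ι)] with t h1 h2 h3 h4
  rw [h1, h2, h4, Pi.smul_apply, h3, gaussianFun_eq, smul_eq_mul, scaledGaussian, scaledGaussian,
    norm_smul]
  congr 2
  push_cast
  norm_num
  ring

theorem m1Norm_dilation_le (f : L2 ι) :
    m1Norm (dilation f) ≤ m1Norm f * m1Norm (dilation (gaussian : L2 ι)) :=
  m1Norm_map_le dilation (fun u => by rw [dilation_symShift, m1Norm_symShift]) f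

theorem m1Norm_dilation_gaussian_lt_top : m1Norm (dilation (gaussian : L2 ι)) < ∞ := by
  rw [dilation_gaussian, m1Norm_smul]
  exact ENNReal.mul_lt_top (by simp) (m1Norm_scaledGaussianL2_lt_top four_pos)

/-! ### The symplectic Fourier transform of the ambiguity function -/

theorem fourier_symShift (Z : E (ι ⊕ ι)) (F : L2 ι) (w : E ι) :
    𝓕 (symShift Z F : E ι → ℂ) w =
      Complex.exp (Real.pi * Complex.I *
        ((inner ℝ (-pos Z) ((2 : ℝ) • w - freq Z) : ℝ) : ℂ)) * 𝓕 (F : E ι → ℂ) (w - freq Z) := by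
  rw [Real.fourier_congr_ae (coeFn_symShift Z F), Real.fourier_eq', Real.fourier_eq',
    ← integral_add_right_eq_self _ (pos Z), ← integral_const_mul]
  refine integral_congr_ae (Eventually.of_forall fun t => ?_)
  simp only [smul_eq_mul, add_sub_cancel_right, ← mul_assoc, ← Complex.exp_add]
  congr 2
  simp only [inner_sub_right, inner_smul_right, inner_add_left, inner_add_right, inner_neg_left]
  rw [real_inner_comm (freq Z) t, real_inner_comm (freq Z) (pos Z)]
  push_cast; ring

theorem fourier_scaledGaussian {a : ℝ} (ha : 0 < a) (w : E ι) :
    𝓕 (scaledGaussian (ι := ι) a) w =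
      (1 / (a : ℂ)) ^ ((Fintype.card ι : ℂ) / 2) * scaledGaussian (1 / a) w := by
  have h : scaledGaussian (ι := ι) a =
      fun v => Complex.exp (-((Real.pi * a : ℝ) : ℂ) * (‖v‖ : ℂ) ^ 2) := by
    funext v
    simp [scaledGaussian]
  have ha' : (a : ℂ) ≠ 0 := by exact_mod_cast ha.ne'
  have hpi : (Real.pi : ℂ) ≠ 0 := by exact_mod_cast Real.pi_ne_zero
  rw [h, fourier_gaussian_innerProductSpace (by simpa using mul_pos Real.pi_pos ha),
    finrank_euclideanSpace, scaledGaussian]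
  congr 2
  · push_cast
    field_simp
  · push_cast
    field_simp

theorem integrable_scaledGaussianL2 {a : ℝ} (ha : 0 < a) :
    Integrable (scaledGaussianL2 ha : L2 ι) volume :=
  (integrable_scaledGaussian ha).congr (coeFn_scaledGaussianL2 ha).symm

theorem integrable_symShift (z : E (ι ⊕ ι)) {f : L2 ι} (hf : Integrable f volume) :
    Integrable (symShift z f : L2 ι) volume := by
  refine Integrable.mono ((measurePreserving_sub (pos z)).integrable_comp_of_integrable hf)
    (Lp.aestronglyMeasurable _) ?_
  filter_upwards [coeFn_symShift z f] with t ht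
  rw [ht, norm_mul, norm_exp_pi_I_mul, one_mul, Function.comp_apply]

/-- The symplectic Fourier transform as a bounded operator. -/
def symplFourierCLM : BoundedOp (ι ⊕ ι) :=
  (Lp.compMeasurePreservingₗᵢ ℂ (rotation : E (ι ⊕ ι) → E (ι ⊕ ι))
    measurePreserving_rotation).toContinuousLinearMap ∘L
    (Lp.fourierTransformₗᵢ (E (ι ⊕ ι)) ℂ).toContinuousLinearEquiv.toContinuousLinearMap

theorem coeFn_symplFourierCLM (a : L2 (ι ⊕ ι)) :
    (symplFourierCLM a : E (ι ⊕ ι) → ℂ) =ᵐ[volume] symplFourier a :=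
  Lp.coeFn_compMeasurePreserving (𝓕 a : L2 (ι ⊕ ι)) measurePreserving_rotation

theorem symplFourier_ae_eq {a : L2 (ι ⊕ ι)} (ha : Integrable a volume) :
    symplFourier a =ᵐ[volume] fun z => 𝓕 (a : E (ι ⊕ ι) → ℂ) (rotation z) :=
  measurePreserving_rotation.quasiMeasurePreserving.ae (fourier_L2_ae_eq a ha)

/-- Both sides are explicit: the Gaussian `exp(-π|·|²/2)` on `ℝ²ⁿ` has transform `2ⁿ exp(-2π|·|²)`,
which is `2ⁿ` times the original at the doubled argument. It remains to match phases and centres. -/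
theorem symplFourier_ambiguity_gaussian (u v : E (ι ⊕ ι)) :
    symplFourier (ambiguityL2 (symShift u gaussian) (symShift v gaussian)) =ᵐ[volume]
      fun z => (2 : ℂ) ^ Fintype.card ι *
        ambiguity (symShift u gaussian) (parity (symShift v gaussian)) ((2 : ℝ) • z) := by
  have hG := integrable_scaledGaussianL2 (ι := ι ⊕ ι) (a := 1 / 2) (by norm_num)
  rw [ambiguityL2_symShift, ambiguityL2_gaussian]
  filter_upwards [symplFourier_ae_eq (integrable_symShift
    (point (u - v) ((1 / 2 : ℝ) • rotation (u + v))) hG)] with z hz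
  have hc : (1 / (((1 / 2 : ℝ)) : ℂ)) ^ ((Fintype.card (ι ⊕ ι) : ℂ) / 2) =
      (2 : ℂ) ^ Fintype.card ι := by
    rw [Fintype.card_sum, ← Complex.cpow_natCast]
    push_cast
    congr 1
    · norm_num
    · ring
  rw [hz, fourier_symShift, pos_point, freq_point,
    Real.fourier_congr_ae (coeFn_scaledGaussianL2 (ι := ι ⊕ ι) (a := 1 / 2) (by norm_num)),
    fourier_scaledGaussian (by norm_num), hc, parity_symShift, parity_gaussian,
    ambiguity_symShift_left, ambiguity_symShift_right, ambiguity_gaussian, mul_left_comm,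
    ← mul_assoc (Complex.exp _) (Complex.exp _), ← Complex.exp_add]
  congr 2
  · congr 1
    rw [inner_sub_right, inner_smul_right, inner_smul_right, inner_neg_left, inner_neg_left,
      ← sympl_eq_inner_rotation, ← sympl_eq_inner_rotation]
    simp only [sympl, pos_add, freq_add, pos_sub, freq_sub, pos_smul, freq_smul, pos_neg, freq_neg,
      inner_sub_left, inner_neg_left, inner_neg_right,
      inner_sub_right, inner_add_left, inner_add_right, inner_smul_left, inner_smul_right]
    simp only [conj_trivial]
    push_cast; ring
  -- The centres agree because the rotation is an isometry; halving inside the wider-decaying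
  -- Gaussian matches the exponents.
  · have h : rotation z - (1 / 2 : ℝ) • rotation (u + v) =
        (1 / 2 : ℝ) • rotation ((2 : ℝ) • z - u - v) := by
      rw [map_sub, map_sub, map_add, map_smul, smul_sub, smul_sub, smul_smul, smul_add]
      norm_num
      abel
    rw [h, scaledGaussian, scaledGaussian, norm_smul, norm_rotation, ← sub_eq_add_neg]
    congr 1
    push_cast
    norm_num
    ring

/-- `f ↦ g ↦ 2ⁿ A(f, P g)(2 ·)` as a bounded sesquilinear map. -/
def dilatedAmbiguityCLM : L2 ι →L[ℂ] L2 ι →L⋆[ℂ] L2 (ι ⊕ ι) :=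
  LinearMap.mkContinuous₂
    (LinearMap.mk₂'ₛₗ (RingHom.id ℂ) (starRingEnd ℂ)
      (fun f g => (2 : ℂ) ^ Fintype.card ι • dilation (ambiguityCLM f (parity g)))
      (fun f f' g => by simp only [map_add, add_apply, smul_add])
      (fun c f g => by
        simp only [map_smul, smul_apply, RingHom.id_apply]; rw [smul_comm])
      (fun f g g' => by simp only [map_add, smul_add])
      (fun c f g => by
        simp only [map_smul, map_smulₛₗ]; rw [smul_comm]))
    (2 ^ Fintype.card ι * ‖(dilation : BoundedOp (ι ⊕ ι))‖) (fun f g => by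
      change ‖(2 : ℂ) ^ Fintype.card ι • dilation (ambiguityL2 f (parity g))‖ ≤ _
      rw [norm_smul, norm_pow, Complex.norm_ofNat, mul_assoc, mul_assoc]
      gcongr
      refine (ContinuousLinearMap.le_opNorm _ _).trans_eq ?_
      rw [norm_ambiguityL2, norm_parity])

theorem coeFn_dilatedAmbiguityCLM (f g : L2 ι) :
    (dilatedAmbiguityCLM f g : E (ι ⊕ ι) → ℂ) =ᵐ[volume]
      fun z => (2 : ℂ) ^ Fintype.card ι * ambiguity f (parity g) ((2 : ℝ) • z) := by
  filter_upwards [Lp.coeFn_smul ((2 : ℂ) ^ Fintype.card ι)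
      (dilation (ambiguityL2 f (parity g))), coeFn_dilation (ambiguityL2 f (parity g)),
    quasiMeasurePreserving_two_smul.ae (coeFn_ambiguityL2 f (parity g))] with z h1 h2 h3
  change ((2 : ℂ) ^ Fintype.card ι • dilation (ambiguityL2 f (parity g)) : L2 (ι ⊕ ι)) z = _
  rw [h1, Pi.smul_apply, h2, h3, smul_eq_mul]

/-- Continuity and density extend the identity from atoms, in the second argument and then in the
first. -/
theorem symplFourierCLM_ambiguityL2 (f g : L2 ι) :
    symplFourierCLM (ambiguityL2 f g) = dilatedAmbiguityCLM f g := by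
  have key : ∀ u, (symplFourierCLM : BoundedOp (ι ⊕ ι)).comp (ambiguityCLM (symShift u gaussian)) =
      dilatedAmbiguityCLM (symShift u (gaussian : L2 ι)) := by
    intro u
    refine ContinuousLinearMap.ext_on dense_span_symShift_gaussian ?_
    rintro _ ⟨v, rfl⟩
    apply Lp.ext
    exact (coeFn_symplFourierCLM _).trans ((symplFourier_ambiguity_gaussian u v).trans
      (coeFn_dilatedAmbiguityCLM _ _).symm)
  have key2 : (symplFourierCLM : BoundedOp (ι ⊕ ι)).comp
      ((ContinuousLinearMap.apply' (L2 (ι ⊕ ι)) (starRingEnd ℂ) g).comp ambiguityCLM) =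
      (ContinuousLinearMap.apply' (L2 (ι ⊕ ι)) (starRingEnd ℂ) g).comp dilatedAmbiguityCLM := by
    refine ContinuousLinearMap.ext_on dense_span_symShift_gaussian ?_
    rintro _ ⟨u, rfl⟩
    exact congrArg (fun T => T g) (key u)
  exact congrArg (fun T => T f) key2

theorem symplFourier_ambiguityL2 (f g : L2 ι) :
    symplFourier (ambiguityL2 f g) =ᵐ[volume]
      fun z => (2 : ℂ) ^ Fintype.card ι * ambiguity f (parity g) ((2 : ℝ) • z) := by
  refine (coeFn_symplFourierCLM _).symm.trans ?_
  rw [symplFourierCLM_ambiguityL2]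
  exact coeFn_dilatedAmbiguityCLM f g

theorem ip_smul_opTranslate_parity (f g : L2 ι) (z : E (ι ⊕ ι)) :
    ip f (((2 : ℂ) ^ Fintype.card ι • opTranslate z parity) g) =
      (2 : ℂ) ^ Fintype.card ι * ambiguity f (parity g) ((2 : ℝ) • z) := by
  rw [smul_apply, ip_smul_right, opTranslate_parity_apply, ambiguity_eq, map_pow]
  congr 2
  exact Complex.conj_ofNat 2

/-- Both sides are continuous, so almost everywhere equality is equality at every point; this is
what a statement for each fixed `z` needs. -/
theorem fourier_ambiguity (f g : M1 ι) (z : E (ι ⊕ ι)) :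
    𝓕 (ambiguity (f : L2 ι) (g : L2 ι)) (rotation z) =
      (2 : ℂ) ^ Fintype.card ι * ambiguity (f : L2 ι) (parity (g : L2 ι)) ((2 : ℝ) • z) := by
  have hi := integrable_ambiguity f g
  have hc := coeFn_ambiguityL2 (f : L2 ι) (g : L2 ι)
  have h1 := (symplFourier_ae_eq (hi.congr hc.symm)).symm.trans
    (symplFourier_ambiguityL2 (f : L2 ι) (g : L2 ι))
  have h2 : Continuous (rotation : E (ι ⊕ ι) → E (ι ⊕ ι)) :=
    (rotationₗᵢ (ι := ι)).continuous
  have h3 : (fun z => 𝓕 (ambiguity (f : L2 ι) (g : L2 ι)) (rotation z)) =ᵐ[volume]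
      fun z => (2 : ℂ) ^ Fintype.card ι *
        ambiguity (f : L2 ι) (parity (g : L2 ι)) ((2 : ℝ) • z) := by
    filter_upwards [h1] with z hz
    rw [← hz, Real.fourier_congr_ae hc]
  refine congrFun ((Continuous.ae_eq_iff_eq volume ((continuous_fourier hi).comp h2) ?_).1 h3) z
  exact continuous_const.mul ((continuous_ambiguity _ _).comp (continuous_const_smul (2 : ℝ)))

theorem hasWeakIntegral_parity (z : E (ι ⊕ ι)) :
    HasWeakIntegral (fun w => phase z w • tfShift w)
      ((2 : ℂ) ^ Fintype.card ι • opTranslate z (parity : BoundedOp ι)) := by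
  intro f g
  -- The weak integrand is the conjugate of a Fourier integrand for `A(g,f)` at the frequency
  -- `rotation z`, with `f` and `g` exchanged.
  have h : ∀ w, ip ((phase z w • tfShift w) (f : L2 ι)) (g : L2 ι) = starRingEnd ℂ
      (Complex.exp (((-2 * Real.pi * inner ℝ w (rotation z) : ℝ) : ℂ) * Complex.I) •
        ambiguity (g : L2 ι) (f : L2 ι) w) := by
    intro w
    rw [phase_smul_tfShift, smul_apply, ip_smul_left, smul_eq_mul, map_mul, ambiguity_eq, conj_ip,
      ← Complex.exp_conj, sympl_eq_inner_rotation]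
    congr 2
    simp only [map_mul, Complex.conj_ofReal, Complex.conj_I]
    push_cast; ring
  simp only [h]
  have hi := integrable_ambiguity g f
  have hm : Continuous fun w : E (ι ⊕ ι) =>
      Complex.exp (((-2 * Real.pi * inner ℝ w (rotation z) : ℝ) : ℂ) * Complex.I) •
        ambiguity (g : L2 ι) (f : L2 ι) w := by
    have h1 := continuous_ambiguity (g : L2 ι) (f : L2 ι)
    simp only [smul_eq_mul]
    fun_prop
  constructor
  · refine (LinearIsometryEquiv.integrable_comp_iff Complex.conjLIE).2 ?_
    refine (integrable_norm_iff hm.aestronglyMeasurable).1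
      (hi.norm.congr (Eventually.of_forall fun w => ?_))
    simp only [norm_smul, Complex.norm_exp_ofReal_mul_I, one_mul]
  · rw [integral_conj, ← Real.fourier_eq', fourier_ambiguity, ← ip_smul_opTranslate_parity, conj_ip]

/-! ### Separation by `M¹` and operators induced by bounded operators on `L²` -/

theorem gaussian_symShift_mem (u : E (ι ⊕ ι)) :
    symShift u (gaussian : L2 ι) ∈ feichtinger ι := by
  rw [← m1Norm_lt_top_iff, m1Norm_symShift]
  exact m1Norm_gaussian_lt_top

/-- Testing against the atoms alone already gives `A(f - h, φ₀) = 0`. -/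
theorem eq_of_ip_M1 {f h : L2 ι} (H : ∀ g : M1 ι, ip f (g : L2 ι) = ip h (g : L2 ι)) : f = h := by
  rw [← sub_eq_zero, ← norm_eq_zero, ← mul_one ‖f - h‖, ← norm_gaussian (ι := ι),
    ← norm_ambiguityL2, norm_eq_zero, Lp.eq_zero_iff_ae_eq_zero]
  filter_upwards [coeFn_ambiguityL2 (f - h) gaussian] with z hz
  have := H ⟨_, gaussian_symShift_mem z⟩
  rw [hz, ambiguity_eq, ip, inner_sub_right]
  exact sub_eq_zero.2 this

theorem eq_of_forall_ip_M1 {T T' : BoundedOp ι}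
    (H : ∀ f g : M1 ι, ip (T f) (g : L2 ι) = ip (T' f) (g : L2 ι)) : T = T' := by
  refine ContinuousLinearMap.ext_on dense_span_symShift_gaussian ?_
  rintro _ ⟨u, rfl⟩
  exact eq_of_ip_M1 fun g => H ⟨_, gaussian_symShift_mem u⟩ g

theorem exists_isInducedBy (T : BoundedOp ι) : ∃ S : MInfOp ι, IsInducedBy S T := by
  refine ⟨LinearMap.mkContinuous₂
    (LinearMap.mk₂'ₛₗ (RingHom.id ℂ) (starRingEnd ℂ) (fun f g : M1 ι => ip (T f) (g : L2 ι))
      (fun f f' g => by simp only [map_add, ip_add_left])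
      (fun c f g => by simp only [map_smul, ip_smul_left, RingHom.id_apply, smul_eq_mul])
      (fun f g g' => by simp only [map_add, ip_add_right])
      (fun c f g => by simp only [map_smul, ip_smul_right, smul_eq_mul]))
    ‖T‖ (fun f g => ?_), fun f g => rfl⟩
  refine (norm_ip_le _ _).trans ?_
  gcongr
  · exact (T.le_opNorm _).trans (by gcongr; exact f.norm_toL2_le)
  · exact g.norm_toL2_le

/-! ### Weyl quantisation -/

/-- Substituting `x + t/2` for the integration variable of the ambiguity function at `2z` turns `Pf`
into `f(x - t/2)`; the Jacobian accounts for `2ⁿ`. -/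
theorem wigner_eq (g f : L2 ι) (z : E (ι ⊕ ι)) :
    wigner g f z =
      (2 : ℂ) ^ Fintype.card ι * ambiguity g (parity f) ((2 : ℝ) • z) := by
  have h1 : ambiguity g (parity f) ((2 : ℝ) • z) = ∫ t, g t * starRingEnd ℂ
      (Complex.exp (Real.pi * Complex.I *
        ((inner ℝ ((2 : ℝ) • freq z) ((2 : ℝ) • t - (2 : ℝ) • pos z) : ℝ) : ℂ)) *
        f (-(t - (2 : ℝ) • pos z))) := by
    rw [ambiguity_eq, ip_eq_integral]
    refine integral_congr_ae ?_
    filter_upwards [coeFn_symShift ((2 : ℝ) • z) (parity f),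
      (measurePreserving_sub ((2 : ℝ) • pos z)).quasiMeasurePreserving.ae (coeFn_parity f)]
      with t h1 h2
    rw [h1, pos_smul, freq_smul, h2]
  rw [h1, ← integral_add_left_eq_self _ (pos z), wigner]
  set H : E ι → ℂ := fun s => g (pos z + s) * starRingEnd ℂ
      (Complex.exp (Real.pi * Complex.I *
        ((inner ℝ ((2 : ℝ) • freq z) ((2 : ℝ) • (pos z + s) - (2 : ℝ) • pos z) : ℝ) : ℂ)) *
        f (-(pos z + s - (2 : ℝ) • pos z))) with hH
  have h2 := Measure.integral_comp_smul volume H (1 / 2 : ℝ)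
  rw [finrank_euclideanSpace] at h2
  have h3 : |((1 / 2 : ℝ) ^ Fintype.card ι)⁻¹| = 2 ^ Fintype.card ι := by
    rw [abs_of_pos (by positivity)]; simp
  rw [h3, Complex.real_smul] at h2
  push_cast at h2
  rw [← h2]
  refine integral_congr_ae (Eventually.of_forall fun t => ?_)
  simp only [hH]
  rw [map_mul, conj_exp_pi_I_mul, mul_assoc, mul_comm (starRingEnd ℂ _) (Complex.exp _)]
  congr 3
  · simp only [inner_sub_right, inner_smul_right, inner_smul_left, inner_add_right, conj_trivial]
    push_cast; ring
  · congr 2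
    rw [two_smul]
    abel

theorem wigner_eq_ip (g f : L2 ι) (z : E (ι ⊕ ι)) :
    wigner g f z = (2 : ℂ) ^ Fintype.card ι * starRingEnd ℂ (ip (opTranslate z parity f) g) := by
  rw [wigner_eq, opTranslate_parity_apply, conj_ip, ambiguity_eq]

theorem m1Norm_parity_le (f : L2 ι) :
    m1Norm (parity f) ≤ m1Norm f * m1Norm (gaussian : L2 ι) :=
  m1Norm_map_le parity (fun u => by rw [parity_symShift, parity_gaussian, m1Norm_symShift]) f

theorem parity_mem (f : M1 ι) : parity (f : L2 ι) ∈ feichtinger ι := by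
  rw [← m1Norm_lt_top_iff]
  exact (m1Norm_parity_le _).trans_lt (ENNReal.mul_lt_top f.m1Norm_lt_top m1Norm_gaussian_lt_top)

theorem M1.ext {f g : M1 ι} (h : (f : L2 ι) = g) : f = g := Subtype.ext h

/-- An element of `M¹` is determined by its almost everywhere class, so the bracket can be evaluated
on any known representative. -/
theorem hasBracket_iff {σ : MInf ι} {F : E ι → ℂ} {m : M1 ι}
    (hm : ((m : L2 ι) : E ι → ℂ) =ᵐ[volume] F) {c : ℂ} : HasBracket σ F c ↔ σ m = c := by
  refine ⟨?_, fun h => ⟨m, hm, h⟩⟩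
  rintro ⟨m', hm', rfl⟩
  rw [M1.ext (Lp.ext (hm.trans hm'.symm))]

theorem M1.norm_le_of_m1Norm_le {f : M1 ι} {c : ℝ} (hc : 0 ≤ c)
    (h : m1Norm (f : L2 ι) ≤ ENNReal.ofReal c) : ‖f‖ ≤ c := by
  rwa [M1.m1Norm_eq, ENNReal.ofReal_le_ofReal_iff hc] at h

theorem m1Norm_ambiguityL2_lt_top {f g : L2 ι} (hf : f ∈ feichtinger ι) (hg : g ∈ feichtinger ι) :
    m1Norm (ambiguityL2 f g) < ∞ := by
  rw [← m1Norm_lt_top_iff] at hf hg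
  refine (m1Norm_ambiguityL2_le f g).trans_lt (ENNReal.mul_lt_top hf (ENNReal.mul_lt_top hg ?_))
  rw [ambiguityL2_gaussian]
  exact m1Norm_scaledGaussianL2_lt_top _

/-- The bound of the Wigner distribution as a sesquilinear map on `M¹`. -/
def wignerBound (ι : Type) [Fintype ι] : ℝ≥0∞ :=
  2 ^ Fintype.card ι * (m1Norm (gaussian : L2 ι) *
    m1Norm (ambiguityL2 (gaussian : L2 ι) gaussian) * m1Norm (dilation (gaussian : L2 (ι ⊕ ι))))

theorem wignerBound_lt_top : wignerBound ι < ∞ := by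
  refine ENNReal.mul_lt_top (by simp) (ENNReal.mul_lt_top (ENNReal.mul_lt_top
    m1Norm_gaussian_lt_top ?_) m1Norm_dilation_gaussian_lt_top)
  rw [ambiguityL2_gaussian]
  exact m1Norm_scaledGaussianL2_lt_top _

theorem m1Norm_dilatedAmbiguityCLM_le (g f : L2 ι) :
    m1Norm (dilatedAmbiguityCLM g f) ≤ wignerBound ι * m1Norm f * m1Norm g := by
  have h : dilatedAmbiguityCLM g f =
    (2 : ℂ) ^ Fintype.card ι • dilation (ambiguityL2 g (parity f)) := rfl
  have h2 : ‖(2 : ℂ) ^ Fintype.card ι‖ₑ = 2 ^ Fintype.card ι := by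
    rw [enorm_pow, ← ofReal_norm, Complex.norm_ofNat]
    simp
  rw [h, m1Norm_smul, h2, wignerBound]
  calc _ ≤ 2 ^ Fintype.card ι * ((m1Norm g * (m1Norm f * m1Norm (gaussian : L2 ι) *
        m1Norm (ambiguityL2 (gaussian : L2 ι) gaussian))) *
          m1Norm (dilation (gaussian : L2 (ι ⊕ ι)))) := by
        gcongr
        refine (m1Norm_dilation_le _).trans ?_
        gcongr
        refine (m1Norm_ambiguityL2_le _ _).trans ?_
        gcongr
        exact m1Norm_parity_le f
    _ = _ := by ring

/-- The cross-Wigner distribution `W(g, f)` as an element of `M¹(ℝ²ⁿ)`. -/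
def wignerM1 (g f : M1 ι) : M1 (ι ⊕ ι) :=
  ⟨dilatedAmbiguityCLM (g : L2 ι) (f : L2 ι), by
    rw [← m1Norm_lt_top_iff]
    exact (m1Norm_dilatedAmbiguityCLM_le _ _).trans_lt (ENNReal.mul_lt_top
      (ENNReal.mul_lt_top wignerBound_lt_top f.m1Norm_lt_top) g.m1Norm_lt_top)⟩

theorem toL2_wignerM1 (g f : M1 ι) :
    (wignerM1 g f : L2 (ι ⊕ ι)) = dilatedAmbiguityCLM (g : L2 ι) (f : L2 ι) := rfl

theorem coeFn_wignerM1 (g f : M1 ι) :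
    ((wignerM1 g f : L2 (ι ⊕ ι)) : E (ι ⊕ ι) → ℂ) =ᵐ[volume] wigner (g : L2 ι) (f : L2 ι) := by
  refine (coeFn_dilatedAmbiguityCLM _ _).trans (Eventually.of_forall fun z => ?_)
  exact (wigner_eq _ _ _).symm

theorem norm_wignerM1_le (g f : M1 ι) :
    ‖wignerM1 g f‖ ≤ (wignerBound ι).toReal * ‖f‖ * ‖g‖ := by
  refine M1.norm_le_of_m1Norm_le (by positivity) ?_
  refine (m1Norm_dilatedAmbiguityCLM_le _ _).trans_eq ?_
  rw [M1.m1Norm_eq, M1.m1Norm_eq, ENNReal.ofReal_mul (by positivity),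
    ENNReal.ofReal_mul (by positivity), ENNReal.ofReal_toReal wignerBound_lt_top.ne]

/-- The Weyl quantisation `⟨L_σ f, g⟩ = ⟨σ, W(g, f)⟩`. -/
def weylQuantisation (σ : MInf (ι ⊕ ι)) : MInfOp ι :=
  LinearMap.mkContinuous₂
    (LinearMap.mk₂'ₛₗ (RingHom.id ℂ) (starRingEnd ℂ) (fun f g : M1 ι => σ (wignerM1 g f))
      (fun f f' g => by
        rw [← map_add]
        exact congrArg σ (M1.ext (by simp only [toL2_wignerM1, map_add])))
      (fun c f g => by
        have h : wignerM1 g (c • f) = starRingEnd ℂ c • wignerM1 g f :=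
          M1.ext (by simp only [toL2_wignerM1, map_smul, map_smulₛₗ])
        rw [h, map_smulₛₗ, Complex.conj_conj, RingHom.id_apply])
      (fun f g g' => by
        rw [← map_add]
        exact congrArg σ (M1.ext (by simp only [toL2_wignerM1, map_add, add_apply])))
      (fun c f g => by
        have h : wignerM1 (c • g) f = c • wignerM1 g f :=
          M1.ext (by simp only [toL2_wignerM1, map_smul, smul_apply])
        rw [h, map_smulₛₗ]))
    (‖σ‖ * (wignerBound ι).toReal) (fun f g => by
      refine (σ.le_opNorm _).trans ?_
      rw [mul_assoc, mul_assoc, ← mul_assoc _ ‖f‖]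
      gcongr
      exact norm_wignerM1_le g f)

theorem weylQuantisation_apply (σ : MInf (ι ⊕ ι)) (f g : M1 ι) :
    weylQuantisation σ f g = σ (wignerM1 g f) := rfl

theorem isWeylQuantisation_iff {σ : MInf (ι ⊕ ι)} {L : MInfOp ι} :
    IsWeylQuantisation σ L ↔ L = weylQuantisation σ := by
  simp only [IsWeylQuantisation, hasBracket_iff (coeFn_wignerM1 _ _)]
  constructor
  · intro h
    ext f g
    rw [← h, weylQuantisation_apply]
  · rintro rfl f g
    rfl

/-- The function `2ⁿ F(2 ·)` as an element of `M¹(ℝⁿ)`. -/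
def dilationM1 (F : M1 ι) : M1 ι :=
  ⟨(2 : ℂ) ^ Fintype.card ι • dilation (F : L2 ι), by
    refine (feichtinger ι).smul_mem _ ?_
    rw [← m1Norm_lt_top_iff]
    exact (m1Norm_dilation_le _).trans_lt
      (ENNReal.mul_lt_top F.m1Norm_lt_top m1Norm_dilation_gaussian_lt_top)⟩

theorem toL2_dilationM1 (F : M1 ι) :
    (dilationM1 F : L2 ι) = (2 : ℂ) ^ Fintype.card ι • dilation (F : L2 ι) := rfl

theorem coeFn_dilationM1 (F : M1 ι) :
    ((dilationM1 F : L2 ι) : E ι → ℂ) =ᵐ[volume]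
      fun z => (2 : ℂ) ^ Fintype.card ι * (F : L2 ι) ((2 : ℝ) • z) := by
  filter_upwards [Lp.coeFn_smul ((2 : ℂ) ^ Fintype.card ι) (dilation (F : L2 ι)),
    coeFn_dilation (F : L2 ι)] with z h1 h2
  rw [toL2_dilationM1, h1, Pi.smul_apply, h2, smul_eq_mul]

theorem norm_dilationM1_le (F : M1 ι) :
    ‖dilationM1 F‖ ≤
      2 ^ Fintype.card ι * (m1Norm (dilation (gaussian : L2 ι))).toReal * ‖F‖ := by
  refine M1.norm_le_of_m1Norm_le (by positivity) ?_
  rw [toL2_dilationM1, m1Norm_smul, mul_assoc, ENNReal.ofReal_mul (by positivity),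
    ENNReal.ofReal_mul (by positivity), ENNReal.ofReal_toReal m1Norm_dilation_gaussian_lt_top.ne,
    mul_comm (m1Norm _), ← M1.m1Norm_eq, ← ofReal_norm, norm_pow, Complex.norm_ofNat]
  gcongr
  exact m1Norm_dilation_le _

/-- The dilated distribution `σ(· / 2)`. -/
def halfDilation (σ : MInf ι) : MInf ι :=
  LinearMap.mkContinuous
    { toFun := fun F => σ (dilationM1 F)
      map_add' := fun F G => by
        rw [← map_add]
        exact congrArg σ (M1.ext (by simp only [toL2_dilationM1, map_add, smul_add]))
      map_smul' := fun c F => by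
        have h : dilationM1 (c • F) = c • dilationM1 F :=
          M1.ext (by simp only [toL2_dilationM1, map_smul]; rw [smul_comm])
        rw [h, map_smulₛₗ] }
    (‖σ‖ * (2 ^ Fintype.card ι * (m1Norm (dilation (gaussian : L2 ι))).toReal)) fun F => by
      refine (σ.le_opNorm _).trans ?_
      rw [mul_assoc ‖σ‖]
      gcongr
      exact norm_dilationM1_le F

theorem isHalfDilation_halfDilation (σ : MInf ι) : IsHalfDilation σ (halfDilation σ) :=
  fun F => ⟨dilationM1 F, coeFn_dilationM1 F, rfl⟩

theorem hasDualIntegral_opTranslate_parity (σ : MInf (ι ⊕ ι)) :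
    HasDualIntegral σ (fun z => opTranslate z parity)
      (((2 : ℂ) ^ Fintype.card ι)⁻¹ • weylQuantisation σ) := by
  intro f g
  refine ⟨((2 : ℂ) ^ Fintype.card ι)⁻¹ • wignerM1 g f, ?_, ?_⟩
  · rw [map_smul]
    filter_upwards [Lp.coeFn_smul ((2 : ℂ) ^ Fintype.card ι)⁻¹ (wignerM1 g f : L2 (ι ⊕ ι)),
      coeFn_wignerM1 g f] with z h1 h2
    rw [h1, Pi.smul_apply, h2, wigner_eq_ip, smul_eq_mul, inv_mul_cancel_left₀ (pow_ne_zero _ two_ne_zero)]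
  -- The functional is antilinear, but the scalar is real and comes out unchanged.
  · rw [map_smulₛₗ, map_inv₀, map_pow, Complex.conj_ofNat]
    rfl

theorem hasDualIntegral_shiftedParity (σ : MInf (ι ⊕ ι)) :
    HasDualIntegral (halfDilation σ) shiftedParity
      ((2 : ℂ) ^ Fintype.card ι • weylQuantisation σ) := by
  intro f g
  obtain ⟨A, hA⟩ : ∃ A : M1 (ι ⊕ ι), (A : L2 (ι ⊕ ι)) =
      ambiguityL2 (g : L2 ι) (parity (f : L2 ι)) :=
    ⟨⟨_, (m1Norm_lt_top_iff _).1 (m1Norm_ambiguityL2_lt_top g.2 (parity_mem f))⟩, rfl⟩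
  refine ⟨A, ?_, ?_⟩
  · rw [hA]
    refine (coeFn_ambiguityL2 _ _).trans (Eventually.of_forall fun z => ?_)
    simp only [conj_ip, shiftedParity_apply, ambiguity_eq]
  -- Dilation on `ℝ²ⁿ` brings the factor `2²ⁿ = 2ⁿ · 2ⁿ`; one `2ⁿ` is absorbed in `W(g,f) = 2ⁿ
  -- A(g,Pf)(2·)`, the other remains and is undone by the `2⁻ⁿ` of the final formula.
  · have h : dilationM1 A = (2 : ℂ) ^ Fintype.card ι • wignerM1 g f := by
      refine M1.ext ?_
      rw [toL2_dilationM1, hA, map_smul, toL2_wignerM1, Fintype.card_sum, pow_add, mul_smul]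
      rfl
    change σ (dilationM1 A) = _
    rw [h, map_smulₛₗ, map_pow, Complex.conj_ofNat]
    rfl

end TimeFreq

end

open TimeFreq
theorem proposition4 (d : ℕ) :
    (∀ z : E (Fin d ⊕ Fin d),
      (∃! T : BoundedOp (Fin d), HasWeakIntegral (fun z' => phase z z' • tfShift z') T) ∧
      HasWeakIntegral (fun z' => phase z z' • tfShift z')
        ((2 : ℂ) ^ d • opTranslate z (parity : BoundedOp (Fin d))) ∧
      ∃ S : MInfOp (Fin d),
        IsInducedBy S ((2 : ℂ) ^ d • opTranslate z (parity : BoundedOp (Fin d)))) ∧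
    (∀ f g : L2 (Fin d), ∃ a : L2 (Fin d ⊕ Fin d),
      a =ᵐ[volume] ambiguity f g ∧
      symplFourier a =ᵐ[volume]
        fun z => ip f (((2 : ℂ) ^ d • opTranslate z (parity : BoundedOp (Fin d))) g)) ∧
    (∀ σ : MInf (Fin d ⊕ Fin d), ∃! L : MInfOp (Fin d), IsWeylQuantisation σ L) ∧
    (∀ (σ : MInf (Fin d ⊕ Fin d)) (L : MInfOp (Fin d)), IsWeylQuantisation σ L →
      (∃ S : MInfOp (Fin d), HasDualIntegral σ (fun z => opTranslate z parity) S ∧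
        L = (2 : ℂ) ^ d • S) ∧
      (∃ τ : MInf (Fin d ⊕ Fin d), IsHalfDilation σ τ ∧
        ∃ S : MInfOp (Fin d), HasDualIntegral τ shiftedParity S ∧
          L = ((2 : ℂ) ^ d)⁻¹ • S)) := by
  refine ⟨fun z => ?_, fun f g => ?_, fun σ => ?_, fun σ L hL => ?_⟩
  · have h := hasWeakIntegral_parity z
    rw [Fintype.card_fin] at h
    refine ⟨⟨_, h, fun T hT => ?_⟩, h, exists_isInducedBy _⟩
    exact eq_of_forall_ip_M1 fun f g => (hT f g).2.symm.trans (h f g).2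
  · refine ⟨ambiguityL2 f g, coeFn_ambiguityL2 f g, (symplFourier_ambiguityL2 f g).trans
      (Eventually.of_forall fun z => ?_)⟩
    have h := ip_smul_opTranslate_parity f g z
    rw [Fintype.card_fin] at h
    simp only [Fintype.card_fin]
    exact h.symm
  · exact ⟨weylQuantisation σ, isWeylQuantisation_iff.2 rfl, fun L hL =>
      isWeylQuantisation_iff.1 hL⟩
  · obtain rfl := isWeylQuantisation_iff.1 hL
    have h1 := hasDualIntegral_opTranslate_parity σ
    have h2 := hasDualIntegral_shiftedParity σ
    rw [Fintype.card_fin] at h1 h2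
    have h0 : (2 : ℂ) ^ d ≠ 0 := pow_ne_zero _ two_ne_zero
    exact ⟨⟨_, h1, (smul_inv_smul₀ h0 _).symm⟩,
      halfDilation σ, isHalfDilation_halfDilation σ, _, h2, (inv_smul_smul₀ h0 _).symm⟩
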